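/- Let $\mathbb S^2=\{x\in\mathbb R^3:|x|=1\}$. For a compact set $E\subset\mathbb S^2$ let $\mathcal M(E)$ be the set of positive unit Borel measures supported on $E$, let $I(\mu)=\iint |x-y|^{-1}\,d\mu(x)\,d\mu(y)$ be the Newtonian energy, and put $W(E)=\inf\{I(\mu):\mu\in\mathcal M(E)\}$ and $\operatorname{cap}(E)=1/W(E)$. If $\operatorname{cap}(E)>0$, let $\mu_E$ be the Newtonian equilibrium measure of $E$, that is, the unique $\mu\in\mathcal M(E)$ with $I(\mu)=W(E)$. For a continuous function $Q:\mathbb S^2\to\mathbb R$ define $$\mathcal F(E)=W(E)+\int Q\,d\mu_E .$$ For $0\le\alpha<\pi$ let $$C_{S,\alpha}=\{(\sin\varphi\cos\theta,\ \sin\varphi\sin\theta,\ \cos\varphi):\ \alpha\le\varphi\le\pi,\ 0\le\theta\le2\pi\}$$ be the spherical cap centered at the South Pole, and let $Q(x)=a x_3^2+b x_3+c$ with $a,b,c\in\mathbb R$. **Proposition.** The cap $C_{S,\alpha}$ has positive Newtonian capacity and a unique equilibrium measure $\mu_{C_{S,\alpha}}$, and $$\mathcal F(C_{S,\alpha})=\frac{1}{36(\pi-\alpha+\sin\alpha)}\Big\{\tan\Big(\frac{\alpha}{2}\Big)\Big[32a\cos^3\alpha+4(2a+9b)\cos^2\alpha+4(9c-5a)\cos\alpha+4a-36b+36c\Big]+12(a+3c)(\pi-\alpha)+36\pi\Big\}.$$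 -/

import Mathlib

open MeasureTheory
open scoped ENNReal

noncomputable section

namespace NewtonSphere

/-- Euclidean three-space, with the Euclidean norm. -/
abbrev E3 : Type := EuclideanSpace ℝ (Fin 3)

/-- The class `M(E)`: positive unit Borel measures carried by the set `E` (for compact `E` this
is the same as having support contained in `E`). -/
def unitMeasures (E : Set E3) : Set (Measure E3) :=
  {μ | IsProbabilityMeasure μ ∧ μ Eᶜ = 0}

/-- The Newtonian energy `I(μ) = ∬ 1 / |x - y| dμ(x) dμ(y)`, with values in `[0, ∞]`.
The kernel is `∞` on the diagonal, because `0⁻¹ = ∞` in `ℝ≥0∞`. -/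
def energy (μ : Measure E3) : ℝ≥0∞ :=
  ∫⁻ x, ∫⁻ y, (edist x y)⁻¹ ∂μ ∂μ

/-- The minimal Newtonian energy `W(E) = inf {I(μ) : μ ∈ M(E)}`. -/
def minEnergy (E : Set E3) : ℝ≥0∞ :=
  ⨅ μ ∈ unitMeasures E, energy μ

/-- The Newtonian capacity `cap(E) = 1 / W(E)`. -/
def capacity (E : Set E3) : ℝ≥0∞ :=
  (minEnergy E)⁻¹

/-- `μ` is a Newtonian equilibrium measure of `E` (without external field). -/
def IsEquilibriumMeasure (E : Set E3) (μ : Measure E3) : Prop :=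
  μ ∈ unitMeasures E ∧ energy μ = minEnergy E

open Classical in
/-- The Newtonian equilibrium measure `μ_E` of `E`. It is meaningful when `E` is a compact set of
positive capacity; the value is `0` when `E` has no equilibrium measure. -/
def equilibriumMeasure (E : Set E3) : Measure E3 :=
  if h : ∃ μ, IsEquilibriumMeasure E μ then h.choose else 0

/-- The functional `𝓕(E) = W(E) + ∫ Q dμ_E`, for a compact set `E` of positive capacity. -/
def FFunctional (Q : E3 → ℝ) (E : Set E3) : ℝ :=
  (minEnergy E).toReal + ∫ x, Q x ∂(equilibriumMeasure E)

/-- The point of the unit sphere with azimuth `θ` and polar angle `φ`, where `φ` is measured from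
the North Pole `(0, 0, 1)`. -/
def spherePoint (θ φ : ℝ) : E3 :=
  !₂[Real.sin φ * Real.cos θ, Real.sin φ * Real.sin θ, Real.cos φ]

/-- The spherical cap `C_{S,α}`, centred at the South Pole: all points of the unit sphere with
`α ≤ φ ≤ π` and `0 ≤ θ ≤ 2π`. -/
def southCap (α : ℝ) : Set E3 :=
  {x | ∃ θ φ : ℝ, 0 ≤ θ ∧ θ ≤ 2 * Real.pi ∧ α ≤ φ ∧ φ ≤ Real.pi ∧ x = spherePoint θ φ}

/-- The quadratic field `Q(x) = a x₃² + b x₃ + c`. -/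
def quadraticField (a b c : ℝ) (x : E3) : ℝ :=
  a * x 2 ^ 2 + b * x 2 + c

end NewtonSphere

end

/-!
**Equilibrium of a spherical cap.** The proof exhibits a unit measure on the cap with constant
potential, shows that such a measure is the only minimiser of the energy, and integrates `Q`
against it.

*Uniqueness.* The Newtonian kernel is a superposition of Gaussian kernels
(`inv_edist_eq_lintegral`), and a Gaussian kernel is the Fourier transform of a Gaussian measure.
Hence `I(μ) + I(ν) - 2 I(μ, ν)` is a superposition of square norms of the difference of the
characteristic functions of `μ` and `ν` (`gaussEnergy_sub`): it is nonnegative, and it vanishes only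
if `μ = ν`. If the potential of `ν` equals the constant `W` on the set, then `I(μ, ν) = W = I(ν)` for
every competitor `μ` of finite energy, so that `I(μ) ≥ W` with equality only for `μ = ν`
(`isEquilibriumMeasure_iff_of_potential`).

*Construction.* Stereographic projection from the North Pole turns the cap into the disc of radius
`tan B`, where `B = (π - α) / 2` (the whole plane if `α = 0`), and multiplies the kernel by
`√(1 + |X|²) √(1 + |Y|²) / 2`. One needs a planar density whose potential is a multiple of
`1 / √(1 + |X|²)` on the disc. The density `1 / √(t² - |Y|²)` of a disc of radius `t` has integral `π`
along every line that meets the disc, so in polar coordinates centred at `X` its potential at `X`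
counts the lines through `X` at distance less than `t` from the origin. Mixing these densities with
the weights `sin 2ψ dψ`, `0 < ψ < π / 2`, and radii `t = tan (min ψ B)`, a line at distance `p`
receives `1 / (1 + p²)`, and the average of this over all lines through `X` is `1 / √(1 + |X|²)`
(`lintegral_mixedDensity_mul_inv_dist`).

*Evaluation.* In the plane, `(1 - x₃) / 2` is `1 / (1 + |Y|²)`. Its moments are elementary for one
disc (`lintegral_mul_discDensity`), and the integration in `ψ` is done by parts
(`lintegral_sin_mul_comp_min`). The moment of order `0` gives the total mass, hence the energy
`W = π / (π - α + sin α)`; those of order `1` and `2` give the integral of `Q`.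
-/

noncomputable section

namespace NewtonSphere

open ProbabilityTheory Filter Topology Set

/-! ### Positive definiteness of the Newtonian kernel -/

section PositiveDefinite

set_option linter.unusedSectionVars false

variable {E : Type*} [NormedAddCommGroup E] [InnerProductSpace ℝ E] [FiniteDimensional ℝ E]
  [MeasurableSpace E] [BorelSpace E]

/-- The standard Gaussian measure charges every nonempty open set. -/
instance isOpenPosMeasure_stdGaussian : (stdGaussian E).IsOpenPosMeasure := by
  have : (gaussianReal 0 1).IsOpenPosMeasure :=
    (gaussianReal_absolutelyContinuous' 0 one_ne_zero).isOpenPosMeasure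
  rw [stdGaussian]
  refine Continuous.isOpenPosMeasure_map (by fun_prop) fun v => ?_
  exact ⟨fun i => (stdOrthonormalBasis ℝ E).repr v i, (stdOrthonormalBasis ℝ E).sum_repr v⟩

/-- The mutual energy of `μ` and `ν` for the Gaussian kernel of inverse width `r`. -/
def gaussEnergy (r : ℝ) (μ ν : Measure E) : ℝ :=
  ∫ z : E × E, Real.exp (-‖r • (z.1 - z.2)‖ ^ 2 / 2) ∂(μ.prod ν)

open ComplexConjugate in
/-- Parseval's formula: the Gaussian kernel is the Fourier transform of a Gaussian measure. -/
lemma gaussEnergy_eq_integral_charFun (r : ℝ) (μ ν : Measure E) [IsProbabilityMeasure μ]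
    [IsProbabilityMeasure ν] :
    (gaussEnergy r μ ν : ℂ) =
      ∫ ξ, charFun μ (r • ξ) * conj (charFun ν (r • ξ)) ∂(stdGaussian E) := by
  rw [gaussEnergy, ← integral_complex_ofReal]
  have h1 : ∀ z : E × E, ((Real.exp (-‖r • (z.1 - z.2)‖ ^ 2 / 2) : ℝ) : ℂ) =
      ∫ ξ, Complex.exp (inner ℝ ξ (r • (z.1 - z.2)) * Complex.I) ∂(stdGaussian E) := by
    intro z
    rw [← charFun_apply, charFun_stdGaussian]
    push_cast
    rfl
  simp_rw [h1]
  rw [integral_integral_swap]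
  · refine integral_congr_ae (Eventually.of_forall fun ξ => ?_)
    simp only
    rw [← charFun_neg, charFun_apply, charFun_apply, ← integral_prod_mul]
    refine integral_congr_ae (Eventually.of_forall fun z => ?_)
    simp only
    rw [← Complex.exp_add]
    congr 1
    simp only [inner_smul_right, inner_sub_right, inner_neg_right, real_inner_comm]
    push_cast
    ring
  · refine Integrable.of_bound (C := 1) ?_ (Eventually.of_forall fun z => ?_)
    · refine Continuous.aestronglyMeasurable ?_
      simp only [Function.uncurry_def]
      fun_prop
    · simp only [Function.uncurry]
      rw [Complex.norm_exp_ofReal_mul_I]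

lemma continuous_charFun_prob (μ : Measure E) [IsProbabilityMeasure μ] : Continuous (charFun μ) := by
  unfold charFun
  refine continuous_of_dominated (bound := fun _ => 1) ?_ ?_ (integrable_const _) ?_
  · intro t
    exact Continuous.aestronglyMeasurable (by fun_prop)
  · intro t
    refine Eventually.of_forall fun x => ?_
    rw [Complex.norm_exp_ofReal_mul_I]
  · exact Eventually.of_forall fun x => by fun_prop

/-- The Gaussian energy of the signed measure `μ - ν` is the square norm of its characteristic
function. -/
lemma gaussEnergy_sub (r : ℝ) (μ ν : Measure E) [IsProbabilityMeasure μ] [IsProbabilityMeasure ν] :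
    gaussEnergy r μ μ + gaussEnergy r ν ν - 2 * gaussEnergy r μ ν =
      ∫ ξ, ‖charFun μ (r • ξ) - charFun ν (r • ξ)‖ ^ 2 ∂(stdGaussian E) := by
  have hint : ∀ (μ ν : Measure E) [IsProbabilityMeasure μ] [IsProbabilityMeasure ν],
      Integrable (fun ξ => charFun μ (r • ξ) * (starRingEnd ℂ) (charFun ν (r • ξ)))
        (stdGaussian E) := by
    intro μ ν _ _
    have h1 := continuous_charFun_prob μ
    have h2 := continuous_charFun_prob ν
    refine Integrable.of_bound (C := 1) (Continuous.aestronglyMeasurable (by fun_prop))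
      (Eventually.of_forall fun ξ => ?_)
    rw [norm_mul, RCLike.norm_conj]
    exact mul_le_one₀ (norm_charFun_le_one _) (norm_nonneg _) (norm_charFun_le_one _)
  have hsymm : gaussEnergy r μ ν = gaussEnergy r ν μ := by
    unfold gaussEnergy
    rw [← integral_prod_swap]
    refine integral_congr_ae (Eventually.of_forall fun z => ?_)
    simp only [Prod.fst_swap, Prod.snd_swap]
    rw [← norm_neg, ← smul_neg, neg_sub]
  have h2 : 2 * gaussEnergy r μ ν = gaussEnergy r μ ν + gaussEnergy r ν μ := by
    rw [← hsymm]; ring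
  rw [h2, ← Complex.ofReal_inj, ← integral_complex_ofReal]
  push_cast
  simp_rw [gaussEnergy_eq_integral_charFun]
  rw [← integral_add (hint _ _) (hint _ _), ← integral_add (hint _ _) (hint _ _),
    ← integral_sub (by exact (hint _ _).add (hint _ _)) (by exact (hint _ _).add (hint _ _))]
  refine integral_congr_ae (Eventually.of_forall fun ξ => ?_)
  simp only
  rw [← Complex.mul_conj', map_sub]
  ring

lemma gaussEnergy_nonneg (r : ℝ) (μ ν : Measure E) : 0 ≤ gaussEnergy r μ ν :=
  integral_nonneg fun _ => (Real.exp_pos _).le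

lemma two_mul_gaussEnergy_le (r : ℝ) (μ ν : Measure E) [IsProbabilityMeasure μ]
    [IsProbabilityMeasure ν] :
    2 * gaussEnergy r μ ν ≤ gaussEnergy r μ μ + gaussEnergy r ν ν := by
  have := gaussEnergy_sub r μ ν
  have h : 0 ≤ ∫ ξ, ‖charFun μ (r • ξ) - charFun ν (r • ξ)‖ ^ 2 ∂(stdGaussian E) :=
    integral_nonneg fun _ => by positivity
  linarith

/-- The Gaussian kernel of any width separates probability measures. -/
lemma eq_of_gaussEnergy_eq {r : ℝ} (hr : 0 < r) (μ ν : Measure E) [IsProbabilityMeasure μ]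
    [IsProbabilityMeasure ν]
    (h : 2 * gaussEnergy r μ ν = gaussEnergy r μ μ + gaussEnergy r ν ν) : μ = ν := by
  have h0 : ∫ ξ, ‖charFun μ (r • ξ) - charFun ν (r • ξ)‖ ^ 2 ∂(stdGaussian E) = 0 := by
    rw [← gaussEnergy_sub]; linarith
  have h1 := continuous_charFun_prob μ
  have h2 := continuous_charFun_prob ν
  have hc : Continuous fun ξ : E => ‖charFun μ (r • ξ) - charFun ν (r • ξ)‖ ^ 2 := by fun_prop
  rw [integral_eq_zero_iff_of_nonneg (fun _ => by positivity)] at h0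
  · have h3 := hc.ae_eq_iff_eq (stdGaussian E) continuous_const |>.1 h0
    refine Measure.ext_of_charFun (funext fun t => ?_)
    have h4 := congrFun h3 (r⁻¹ • t)
    simp only [smul_inv_smul₀ hr.ne'] at h4
    exact sub_eq_zero.1 (norm_eq_zero.1 (pow_eq_zero_iff two_ne_zero |>.1 h4))
  · refine Integrable.of_bound (C := 4) hc.aestronglyMeasurable (Eventually.of_forall fun ξ => ?_)
    rw [Real.norm_of_nonneg (by positivity)]
    have h5 : ‖charFun μ (r • ξ) - charFun ν (r • ξ)‖ ≤ 2 := by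
      refine (norm_sub_le _ _).trans ?_
      have := norm_charFun_le_one (μ := μ) (r • ξ)
      have := norm_charFun_le_one (μ := ν) (r • ξ)
      linarith
    nlinarith [norm_nonneg (charFun μ (r • ξ) - charFun ν (r • ξ))]

/-- The Newtonian kernel is a superposition of Gaussian kernels, also on the diagonal. -/
lemma inv_edist_eq_lintegral (x y : E) :
    (edist x y)⁻¹ = ∫⁻ r in Ioi (0 : ℝ),
      ENNReal.ofReal (√(2 / Real.pi) * Real.exp (-‖r • (x - y)‖ ^ 2 / 2)) := by
  rcases eq_or_ne x y with rfl | hxy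
  · simp [Real.pi_pos]
  · have hd : 0 < dist x y := dist_pos.2 hxy
    have hb : 0 < dist x y ^ 2 / 2 := by positivity
    have he : ∀ r : ℝ, -‖r • (x - y)‖ ^ 2 / 2 = -(dist x y ^ 2 / 2) * r ^ 2 := by
      intro r
      rw [norm_smul, dist_eq_norm, mul_pow, Real.norm_eq_abs, sq_abs]; ring
    simp_rw [he]
    rw [← ofReal_integral_eq_lintegral_ofReal
      (((integrable_exp_neg_mul_sq hb).const_mul _).integrableOn)
      (Eventually.of_forall fun r => by positivity),
      integral_const_mul, integral_gaussian_Ioi, edist_dist, ← ENNReal.ofReal_inv_of_pos hd]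
    congr 1
    have h3 : Real.pi / (dist x y ^ 2 / 2) = (2 / dist x y) ^ 2 * (Real.pi / 2) := by
      field_simp
    rw [h3, Real.sqrt_mul (by positivity), Real.sqrt_sq (by positivity)]
    have h4 : √(2 / Real.pi) * √(Real.pi / 2) = 1 := by
      rw [← Real.sqrt_mul (by positivity)]
      have : 2 / Real.pi * (Real.pi / 2) = 1 := by field_simp
      rw [this, Real.sqrt_one]
    calc (dist x y)⁻¹ = (√(2 / Real.pi) * √(Real.pi / 2)) * (dist x y)⁻¹ := by rw [h4, one_mul]
      _ = _ := by field_simp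

/-- The mutual Newtonian energy of two measures. -/
def mutualEnergy (μ ν : Measure E) : ℝ≥0∞ :=
  ∫⁻ x, ∫⁻ y, (edist x y)⁻¹ ∂ν ∂μ

lemma mutualEnergy_eq_lintegral_gaussEnergy (μ ν : Measure E) [IsProbabilityMeasure μ]
    [IsProbabilityMeasure ν] :
    mutualEnergy μ ν =
      ∫⁻ r in Ioi (0 : ℝ), ENNReal.ofReal (√(2 / Real.pi) * gaussEnergy r μ ν) := by
  have hm : Measurable fun p : E × E => (edist p.1 p.2)⁻¹ := by fun_prop
  rw [mutualEnergy, ← lintegral_prod _ hm.aemeasurable]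
  simp_rw [inv_edist_eq_lintegral]
  rw [lintegral_lintegral_swap]
  · refine lintegral_congr fun r => ?_
    rw [gaussEnergy, ← integral_const_mul, ofReal_integral_eq_lintegral_ofReal]
    · refine Integrable.const_mul ?_ _
      refine Integrable.of_bound (C := 1) (Continuous.aestronglyMeasurable (by fun_prop))
        (Eventually.of_forall fun z => ?_)
      rw [Real.norm_of_nonneg (Real.exp_pos _).le, Real.exp_le_one_iff]
      have : 0 ≤ ‖r • (z.1 - z.2)‖ ^ 2 := by positivity
      linarith
    · exact Eventually.of_forall fun z => by positivity
  · refine Measurable.aemeasurable ?_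
    simp only [Function.uncurry_def]
    fun_prop

lemma measurable_gaussEnergy (μ ν : Measure E) [IsProbabilityMeasure μ] [IsProbabilityMeasure ν] :
    Measurable fun r => gaussEnergy r μ ν := by
  refine StronglyMeasurable.measurable ?_
  unfold gaussEnergy
  refine StronglyMeasurable.integral_prod_right' (ν := μ.prod ν)
    (f := fun q : ℝ × (E × E) => Real.exp (-‖q.1 • (q.2.1 - q.2.2)‖ ^ 2 / 2)) ?_
  exact Continuous.stronglyMeasurable (by fun_prop)

/-- The Newtonian kernel is positive definite. -/
lemma two_mul_mutualEnergy_le (μ ν : Measure E) [IsProbabilityMeasure μ]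
    [IsProbabilityMeasure ν] :
    2 * mutualEnergy μ ν ≤ mutualEnergy μ μ + mutualEnergy ν ν := by
  simp_rw [mutualEnergy_eq_lintegral_gaussEnergy]
  have hm := fun (μ ν : Measure E) [IsProbabilityMeasure μ] [IsProbabilityMeasure ν] =>
    ((measurable_gaussEnergy μ ν).const_mul √(2 / Real.pi)).ennreal_ofReal
  rw [← lintegral_const_mul _ (hm μ ν), ← lintegral_add_left (hm μ μ)]
  refine lintegral_mono fun r => ?_
  have h0 := gaussEnergy_nonneg (E := E) r
  rw [← ENNReal.ofReal_add (mul_nonneg (by positivity) (h0 _ _))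
    (mul_nonneg (by positivity) (h0 _ _)), show (2 : ℝ≥0∞) = ENNReal.ofReal 2 by simp,
    ← ENNReal.ofReal_mul (by norm_num)]
  refine ENNReal.ofReal_le_ofReal ?_
  have := mul_le_mul_of_nonneg_left (two_mul_gaussEnergy_le r μ ν) (Real.sqrt_nonneg (2 / Real.pi))
  linarith

/-- The Newtonian kernel is strictly positive definite on measures of finite energy. -/
lemma eq_of_mutualEnergy_eq (μ ν : Measure E) [IsProbabilityMeasure μ] [IsProbabilityMeasure ν]
    (hfin : mutualEnergy μ ν ≠ ∞)
    (h : mutualEnergy μ μ + mutualEnergy ν ν ≤ 2 * mutualEnergy μ ν) : μ = ν := by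
  have hm := fun (μ ν : Measure E) [IsProbabilityMeasure μ] [IsProbabilityMeasure ν] =>
    ((measurable_gaussEnergy μ ν).const_mul √(2 / Real.pi)).ennreal_ofReal
  have h0 := fun r => gaussEnergy_nonneg (E := E) r
  have hsum : mutualEnergy μ μ + mutualEnergy ν ν = ∫⁻ r in Ioi (0 : ℝ),
      ENNReal.ofReal (√(2 / Real.pi) * (gaussEnergy r μ μ + gaussEnergy r ν ν)) := by
    simp_rw [mutualEnergy_eq_lintegral_gaussEnergy]
    rw [← lintegral_add_left (hm μ μ)]
    refine lintegral_congr fun r => ?_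
    rw [mul_add, ENNReal.ofReal_add (mul_nonneg (by positivity) (h0 _ _ _))
      (mul_nonneg (by positivity) (h0 _ _ _))]
  have htwo : 2 * mutualEnergy μ ν = ∫⁻ r in Ioi (0 : ℝ),
      ENNReal.ofReal (√(2 / Real.pi) * (2 * gaussEnergy r μ ν)) := by
    rw [mutualEnergy_eq_lintegral_gaussEnergy, ← lintegral_const_mul _ (hm μ ν)]
    refine lintegral_congr fun r => ?_
    rw [show (2 : ℝ≥0∞) = ENNReal.ofReal 2 by simp, ← ENNReal.ofReal_mul (by norm_num)]
    congr 1; ring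
  rw [hsum, htwo] at h
  have hae := ae_eq_of_ae_le_of_lintegral_le (μ := volume.restrict (Ioi (0 : ℝ)))
    (Eventually.of_forall fun r => ENNReal.ofReal_le_ofReal
      (mul_le_mul_of_nonneg_left (two_mul_gaussEnergy_le r μ ν) (Real.sqrt_nonneg (2 / Real.pi))))
    (by rw [← htwo]; exact ENNReal.mul_ne_top (by simp) hfin)
    ((((measurable_gaussEnergy μ μ).add (measurable_gaussEnergy ν ν)).const_mul
      √(2 / Real.pi)).ennreal_ofReal.aemeasurable) h
  have hpos : ∀ᵐ r ∂(volume.restrict (Ioi (0 : ℝ))), 0 < r := ae_restrict_mem measurableSet_Ioi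
  have : (ae (volume.restrict (Ioi (0 : ℝ)))).NeBot := by
    rw [ae_neBot]; simp
  obtain ⟨r, hr, hr0⟩ := (hae.and hpos).exists
  refine eq_of_gaussEnergy_eq hr0 μ ν ?_
  have hc : 0 < √(2 / Real.pi) := Real.sqrt_pos.2 (by positivity)
  rw [ENNReal.ofReal_eq_ofReal_iff (mul_nonneg hc.le (mul_nonneg (by norm_num) (h0 _ _ _)))
    (mul_nonneg hc.le (add_nonneg (h0 _ _ _) (h0 _ _ _)))] at hr
  exact mul_left_cancel₀ hc.ne' hr

end PositiveDefinite

lemma mutualEnergy_self (μ : Measure E3) : mutualEnergy μ μ = energy μ := rfl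

/-- A measure of finite Newtonian energy has no atoms. -/
lemma measure_singleton_eq_zero_of_energy_ne_top {μ : Measure E3} (h : energy μ ≠ ∞) (x : E3) :
    μ {x} = 0 := by
  by_contra h0
  refine h (top_unique ?_)
  calc ∞ = ∫⁻ _ in ({x} : Set E3), ∫⁻ _ in ({x} : Set E3), ∞ ∂μ ∂μ := by
        simp [ENNReal.top_mul h0]
    _ ≤ ∫⁻ x' in ({x} : Set E3), ∫⁻ y in ({x} : Set E3), (edist x' y)⁻¹ ∂μ ∂μ := by
        refine setLIntegral_mono' (measurableSet_singleton x) fun a ha => ?_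
        refine setLIntegral_mono' (measurableSet_singleton x) fun b hb => ?_
        rw [mem_singleton_iff.1 ha, mem_singleton_iff.1 hb]
        simp
    _ ≤ ∫⁻ x' in ({x} : Set E3), ∫⁻ y, (edist x' y)⁻¹ ∂μ ∂μ :=
        lintegral_mono fun a => setLIntegral_le_lintegral _ _
    _ ≤ energy μ := setLIntegral_le_lintegral _ _

/-- Frostman's criterion: a unit measure on `K` whose potential is a finite constant on `K` minus a
point is the unique equilibrium measure. A single point may be left out, because a measure of finite
energy does not charge it. -/
lemma isEquilibriumMeasure_iff_of_potential {K : Set E3} {ν : Measure E3} {W : ℝ≥0∞} (N : E3)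
    (hν : ν ∈ unitMeasures K) (hW : W ≠ ∞) (henergy : energy ν = W)
    (hpot : ∀ x ∈ K, x ≠ N → ∫⁻ y, (edist x y)⁻¹ ∂ν = W) :
    minEnergy K = W ∧ ∀ μ, IsEquilibriumMeasure K μ ↔ μ = ν := by
  have hνp : IsProbabilityMeasure ν := hν.1
  have hmut : ∀ μ ∈ unitMeasures K, energy μ ≠ ∞ → mutualEnergy μ ν = W := by
    intro μ hμ hfin
    have hp : IsProbabilityMeasure μ := hμ.1
    have hae : ∀ᵐ x ∂μ, ∫⁻ y, (edist x y)⁻¹ ∂ν = W := by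
      have h1 : ∀ᵐ x ∂μ, x ∈ K := by
        rw [ae_iff]; exact hμ.2
      have h2 : ∀ᵐ x ∂μ, x ≠ N := by
        rw [ae_iff]
        simpa using measure_singleton_eq_zero_of_energy_ne_top hfin N
      filter_upwards [h1, h2] with x hx1 hx2 using hpot x hx1 hx2
    rw [mutualEnergy, lintegral_congr_ae hae]
    simp
  have hle : ∀ μ ∈ unitMeasures K, W ≤ energy μ := by
    intro μ hμ
    by_cases hfin : energy μ = ∞
    · rw [hfin]; exact le_top
    have hp : IsProbabilityMeasure μ := hμ.1
    have h := two_mul_mutualEnergy_le μ ν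
    rw [hmut μ hμ hfin, mutualEnergy_self, mutualEnergy_self, henergy, two_mul] at h
    exact (ENNReal.add_le_add_iff_right hW).1 h
  have hmin : minEnergy K = W :=
    le_antisymm (henergy ▸ iInf₂_le ν hν) (le_iInf₂ hle)
  refine ⟨hmin, fun μ => ⟨fun h => ?_, fun h => ?_⟩⟩
  · have hp : IsProbabilityMeasure μ := h.1.1
    have hfin : energy μ = W := h.2.trans hmin
    have hm := hmut μ h.1 (hfin ▸ hW)
    refine eq_of_mutualEnergy_eq μ ν (hm ▸ hW) ?_
    rw [hm, mutualEnergy_self, mutualEnergy_self, henergy, hfin, two_mul]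
  · rw [h]
    exact ⟨hν, henergy.trans hmin.symm⟩

/-! ### The planar potential of a superposition of disc charges -/

lemma lintegral_deriv_eq_sub {f f' : ℝ → ℝ} {a b : ℝ} (hab : a ≤ b)
    (hcont : ContinuousOn f (Icc a b)) (hderiv : ∀ x ∈ Ioo a b, HasDerivAt f (f' x) x)
    (hpos : ∀ x ∈ Ioo a b, 0 ≤ f' x) :
    ∫⁻ x in Ioo a b, ENNReal.ofReal (f' x) = ENNReal.ofReal (f b - f a) := by
  have hint := intervalIntegral.integrableOn_deriv_of_nonneg hcont hderiv hpos
  rw [← intervalIntegral.integral_eq_sub_of_hasDerivAt_of_le hab hcont hderiv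
    ((intervalIntegrable_iff_integrableOn_Ioc_of_le hab).2 hint),
    intervalIntegral.integral_of_le hab, integral_Ioc_eq_integral_Ioo,
    ofReal_integral_eq_lintegral_ofReal (hint.mono_set Ioo_subset_Ioc_self)]
  exact (ae_restrict_iff' measurableSet_Ioo).2 (Eventually.of_forall hpos)

lemma lintegral_eq_lintegral_affine {G : ℝ → ℝ≥0∞} (hG : Measurable G) {a : ℝ} (ha : a ≠ 0)
    (c : ℝ) : ∫⁻ u, G u = ENNReal.ofReal |a| * ∫⁻ m, G (c + a * m) := by
  rw [← lintegral_add_left_eq_self G c]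
  conv_lhs => rw [← Real.smul_map_volume_mul_left ha]
  rw [lintegral_smul_measure, lintegral_map (by fun_prop) (by fun_prop), smul_eq_mul]

lemma lintegral_eq_setLIntegral_of_eq_zero {f : ℝ → ℝ≥0∞} {s : Set ℝ} (hs : MeasurableSet s)
    (h : ∀ x ∉ s, f x = 0) : ∫⁻ x, f x = ∫⁻ x in s, f x := by
  rw [← lintegral_indicator hs]
  refine lintegral_congr fun x => ?_
  by_cases hx : x ∈ s
  · simp [hx]
  · simp [hx, h x hx]

/-- The square of the Euclidean norm on `ℝ × ℝ` (whose built-in norm is the maximum norm). -/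
def planeSq (Y : ℝ × ℝ) : ℝ := Y.1 ^ 2 + Y.2 ^ 2

@[fun_prop]
lemma continuous_planeSq : Continuous planeSq := by unfold planeSq; fun_prop

lemma planeSq_nonneg (Y : ℝ × ℝ) : 0 ≤ planeSq Y := by unfold planeSq; positivity

/-- Up to the factor `1 / (2πt)`, the density of the Newtonian equilibrium measure of the plane
disc of radius `t`. Outside the disc the square root is `0`, hence so is the density. -/
def discDensity (t : ℝ) (Y : ℝ × ℝ) : ℝ≥0∞ := ENNReal.ofReal (√(t ^ 2 - planeSq Y))⁻¹

/-- The squared distance from the origin to the line through `X` of slope `m`. -/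
def lineDistSq (X : ℝ × ℝ) (m : ℝ) : ℝ := (X.2 - m * X.1) ^ 2 / (1 + m ^ 2)

/-- Integration in polar coordinates centred at `X`, with the slope in place of the angle: the
Jacobian cancels the singularity of the Newtonian kernel. -/
lemma lintegral_mul_inv_dist_eq_slope {F : ℝ × ℝ → ℝ≥0∞} (hF : Measurable F) (X : ℝ × ℝ) :
    ∫⁻ Y, F Y * ENNReal.ofReal (√(planeSq (X - Y)))⁻¹ =
      ∫⁻ m : ℝ, ENNReal.ofReal (√(1 + m ^ 2))⁻¹ * ∫⁻ s : ℝ, F (X.1 + s, X.2 + s * m) := by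
  have hmeas : Measurable fun Y => F Y * ENNReal.ofReal (√(planeSq (X - Y)))⁻¹ := by fun_prop
  rw [Measure.volume_eq_prod, lintegral_prod _ hmeas.aemeasurable,
    ← lintegral_add_left_eq_self _ X.1]
  -- On the vertical line at horizontal distance `s ≠ 0` from `X`, substitute `b = X.2 + s m`.
  have h1 : ∀ᵐ s : ℝ, (∫⁻ b, F (X.1 + s, b) * ENNReal.ofReal (√(planeSq (X - (X.1 + s, b))))⁻¹) =
      ∫⁻ m : ℝ, ENNReal.ofReal (√(1 + m ^ 2))⁻¹ * F (X.1 + s, X.2 + s * m) := by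
    have : ∀ᵐ s : ℝ, s ≠ 0 := by simp [ae_iff]
    filter_upwards [this] with s hs
    rw [lintegral_eq_lintegral_affine (by fun_prop) hs X.2, ← lintegral_const_mul _ (by fun_prop)]
    refine lintegral_congr fun m => ?_
    have h2 : planeSq (X - (X.1 + s, X.2 + s * m)) = s ^ 2 * (1 + m ^ 2) := by
      simp only [planeSq, Prod.fst_sub, Prod.snd_sub]; ring
    rw [h2, Real.sqrt_mul (sq_nonneg s), Real.sqrt_sq_eq_abs, mul_left_comm,
      ← ENNReal.ofReal_mul (abs_nonneg s), mul_comm]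
    congr 2
    have : |s| ≠ 0 := abs_ne_zero.2 hs
    field_simp
  rw [lintegral_congr_ae h1, lintegral_lintegral_swap]
  · refine lintegral_congr fun m => ?_
    rw [lintegral_const_mul _ (by fun_prop)]
  · refine Measurable.aemeasurable ?_
    simp only [Function.uncurry_def]
    fun_prop

lemma lintegral_inv_sqrt_sub_sq (d : ℝ) :
    ∫⁻ s : ℝ, ENNReal.ofReal (√(d - s ^ 2))⁻¹ = if 0 < d then ENNReal.ofReal Real.pi else 0 := by
  split_ifs with hd
  · have hq : 0 < √d := Real.sqrt_pos.2 hd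
    have hqq : √d ^ 2 = d := Real.sq_sqrt hd.le
    rw [lintegral_eq_setLIntegral_of_eq_zero (s := Ioo (-√d) √d) measurableSet_Ioo]
    · rw [lintegral_deriv_eq_sub (f := fun s => Real.arcsin (s / √d)) (by linarith)]
      · congr 1
        simp only [neg_div, div_self hq.ne', Real.arcsin_neg, Real.arcsin_one]
        ring
      · exact (Real.continuous_arcsin.comp (by fun_prop)).continuousOn
      · intro s hs
        have h1 : s / √d < 1 := (div_lt_one hq).2 hs.2
        have h2 : -1 < s / √d := by rw [lt_div_iff₀ hq]; linarith [hs.1]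
        have h3 := (Real.hasDerivAt_arcsin h2.ne' h1.ne).comp s ((hasDerivAt_id s).div_const √d)
        refine h3.congr_deriv ?_
        have h4 : d - s ^ 2 = d * (1 - (s / √d) ^ 2) := by
          rw [div_pow, hqq]; field_simp
        rw [h4, Real.sqrt_mul hd.le]
        simp only [one_div, mul_inv]
        ring
      · intro s _
        positivity
    · intro s hs
      have : d - s ^ 2 ≤ 0 := by
        by_contra! h
        refine hs (abs_lt.1 ?_)
        rw [← Real.sqrt_sq_eq_abs]
        exact Real.sqrt_lt_sqrt (sq_nonneg s) (by linarith)
      simp [Real.sqrt_eq_zero_of_nonpos this]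
  · rw [lintegral_eq_zero_of_ae_eq_zero]
    refine Eventually.of_forall fun s => ?_
    have : d - s ^ 2 ≤ 0 := by nlinarith [sq_nonneg s]
    simp [Real.sqrt_eq_zero_of_nonpos this]

/-- The integral of `discDensity t` over a chord does not depend on the chord. -/
lemma lintegral_discDensity_line (t m : ℝ) (X : ℝ × ℝ) :
    ENNReal.ofReal (√(1 + m ^ 2))⁻¹ * ∫⁻ s : ℝ, discDensity t (X.1 + s, X.2 + s * m) =
      ENNReal.ofReal (Real.pi / (1 + m ^ 2)) * if lineDistSq X m < t ^ 2 then 1 else 0 := by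
  have hm : 0 < 1 + m ^ 2 := by positivity
  set a := √(1 + m ^ 2) with ha_def
  have ha : 0 < a := Real.sqrt_pos.2 hm
  have haa : a ^ 2 = 1 + m ^ 2 := Real.sq_sqrt hm.le
  have h := lintegral_inv_sqrt_sub_sq (t ^ 2 - lineDistSq X m)
  -- Arc length along the line, measured from the foot of the perpendicular from the origin.
  rw [lintegral_eq_lintegral_affine (by fun_prop) ha.ne' ((X.1 + m * X.2) / a),
    abs_of_pos ha] at h
  have h2 : ∀ s, discDensity t (X.1 + s, X.2 + s * m) = ENNReal.ofReal
      (√(t ^ 2 - lineDistSq X m - ((X.1 + m * X.2) / a + a * s) ^ 2))⁻¹ := by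
    intro s
    unfold discDensity
    congr 3
    have : ((X.1 + m * X.2) / a + a * s) ^ 2 =
        (X.1 + m * X.2) ^ 2 / a ^ 2 + 2 * (X.1 + m * X.2) * s + a ^ 2 * s ^ 2 := by
      field_simp; ring
    rw [this, haa]
    simp only [planeSq, lineDistSq]
    field_simp
    ring
  simp_rw [h2]
  have h3 : ENNReal.ofReal a⁻¹ = ENNReal.ofReal (1 + m ^ 2)⁻¹ * ENNReal.ofReal a := by
    rw [← ENNReal.ofReal_mul (by positivity)]
    congr 1
    rw [← haa]; field_simp
  rw [h3, mul_assoc, h, div_eq_mul_inv, mul_comm Real.pi, ENNReal.ofReal_mul (by positivity)]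
  simp only [sub_pos]
  split_ifs <;> simp

lemma lintegral_discDensity_mul_inv_dist (t : ℝ) (X : ℝ × ℝ) :
    ∫⁻ Y, discDensity t Y * ENNReal.ofReal (√(planeSq (X - Y)))⁻¹ =
      ∫⁻ m : ℝ, ENNReal.ofReal (Real.pi / (1 + m ^ 2)) *
        if lineDistSq X m < t ^ 2 then 1 else 0 := by
  rw [lintegral_mul_inv_dist_eq_slope (by unfold discDensity; fun_prop)]
  exact lintegral_congr fun m => lintegral_discDensity_line t m X

lemma lintegral_inv_one_add_sq :
    ∫⁻ u : ℝ, ENNReal.ofReal (1 + u ^ 2)⁻¹ = ENNReal.ofReal Real.pi := by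
  rw [← integral_univ_inv_one_add_sq,
    ofReal_integral_eq_lintegral_ofReal integrable_inv_one_add_sq
      (Eventually.of_forall fun u => by positivity)]

lemma lintegral_inv_one_add_lineDistSq (X : ℝ × ℝ) :
    ∫⁻ m : ℝ, ENNReal.ofReal (Real.pi / (1 + m ^ 2)) * ENNReal.ofReal (1 + lineDistSq X m)⁻¹ =
      ENNReal.ofReal (Real.pi ^ 2 / √(1 + planeSq X)) := by
  obtain ⟨x, y⟩ := X
  have hP : 0 < 1 + planeSq (x, y) := by have := planeSq_nonneg (x, y); linarith
  set q := √(1 + planeSq (x, y)) with hq_def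
  have hq : 0 < q := Real.sqrt_pos.2 hP
  have hqq : q ^ 2 = 1 + (x ^ 2 + y ^ 2) := Real.sq_sqrt hP.le
  have hx : 0 < 1 + x ^ 2 := by positivity
  have ha : 0 < (1 + x ^ 2) / q := by positivity
  have h := lintegral_inv_one_add_sq
  -- The affine substitution completes the square in `(1 + m²) (1 + lineDistSq X m)`.
  rw [lintegral_eq_lintegral_affine (by fun_prop) ha.ne' (-(x * y) / q), abs_of_pos ha] at h
  have h2 : ∀ m : ℝ, ENNReal.ofReal (Real.pi / (1 + m ^ 2)) *
      ENNReal.ofReal (1 + lineDistSq (x, y) m)⁻¹ = ENNReal.ofReal (Real.pi / q) *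
        (ENNReal.ofReal ((1 + x ^ 2) / q) *
          ENNReal.ofReal (1 + (-(x * y) / q + (1 + x ^ 2) / q * m) ^ 2)⁻¹) := by
    intro m
    have hm : 0 < 1 + m ^ 2 := by positivity
    have hpi := Real.pi_pos
    rw [← ENNReal.ofReal_mul (by positivity), ← ENNReal.ofReal_mul (by positivity),
      ← ENNReal.ofReal_mul (by positivity)]
    congr 1
    have e1 : (1 + m ^ 2) * (1 + lineDistSq (x, y) m) =
        (1 + x ^ 2) * m ^ 2 - 2 * x * y * m + 1 + y ^ 2 := by
      simp only [lineDistSq]; field_simp; ring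
    have e2 : q ^ 2 * (1 + (-(x * y) / q + (1 + x ^ 2) / q * m) ^ 2) =
        (1 + x ^ 2) * ((1 + x ^ 2) * m ^ 2 - 2 * x * y * m + 1 + y ^ 2) := by
      have : q ^ 2 * (1 + (-(x * y) / q + (1 + x ^ 2) / q * m) ^ 2) =
          q ^ 2 + (-(x * y) + (1 + x ^ 2) * m) ^ 2 := by field_simp
      rw [this, hqq]; ring
    rw [div_mul_eq_mul_div, ← div_eq_mul_inv, div_div, mul_comm _ (1 + m ^ 2), e1]
    have e3 : Real.pi / q * ((1 + x ^ 2) / q *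
        (1 + (-(x * y) / q + (1 + x ^ 2) / q * m) ^ 2)⁻¹) = Real.pi * (1 + x ^ 2) /
        (q ^ 2 * (1 + (-(x * y) / q + (1 + x ^ 2) / q * m) ^ 2)) := by
      rw [← div_eq_mul_inv, div_div, div_mul_div_comm]
      congr 1; ring
    rw [e3, e2, mul_comm Real.pi, mul_div_mul_left _ _ hx.ne']
  simp_rw [h2]
  rw [lintegral_const_mul _ (by fun_prop), lintegral_const_mul _ (by fun_prop), h,
    ← ENNReal.ofReal_mul (by have := Real.pi_pos; positivity)]
  congr 1; ring

/-- The radius of the `ψ`-th disc: the tangent of `ψ`, truncated at `tan B`. Here `B = π / 2` stands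
for the whole plane: then the truncation is void for `ψ < π / 2`. -/
def discRadius (B ψ : ℝ) : ℝ := Real.tan (min ψ B)

lemma min_mem_Ioo {B ψ : ℝ} (hB : 0 < B) (hψ : ψ ∈ Ioo 0 (Real.pi / 2)) :
    min ψ B ∈ Ioo 0 (Real.pi / 2) :=
  ⟨lt_min hψ.1 hB, (min_le_left _ _).trans_lt hψ.2⟩

lemma discRadius_pos {B ψ : ℝ} (hB : 0 < B) (hψ : ψ ∈ Ioo 0 (Real.pi / 2)) :
    0 < discRadius B ψ :=
  Real.tan_pos_of_pos_of_lt_pi_div_two (min_mem_Ioo hB hψ).1 (min_mem_Ioo hB hψ).2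

lemma lt_discRadius_sq_iff {B ψ P : ℝ} (hB : 0 < B) (hψ : ψ ∈ Ioo 0 (Real.pi / 2)) :
    P < discRadius B ψ ^ 2 ↔ Real.arctan √P < min ψ B := by
  have h := min_mem_Ioo hB hψ
  rw [← Real.sqrt_lt' (discRadius_pos hB hψ), ← Real.arctan_lt_arctan_iff, discRadius,
    Real.arctan_tan (by linarith [h.1, Real.pi_pos]) h.2]

/-- The mixing measure `sin 2ψ dψ` is chosen so that a line at distance `√P` from the origin gets
mass `1 / (1 + P)`. -/
lemma lintegral_sin_mul_indicator {B P : ℝ} (hP : 0 ≤ P) (hB : 0 < B) (hPB : Real.arctan √P < B) :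
    ∫⁻ ψ in Ioo 0 (Real.pi / 2), ENNReal.ofReal (Real.sin (2 * ψ)) *
      (if P < discRadius B ψ ^ 2 then 1 else 0) = ENNReal.ofReal (1 + P)⁻¹ := by
  have h0 : 0 ≤ Real.arctan √P := Real.arctan_nonneg.2 (Real.sqrt_nonneg P)
  have h1 := Real.arctan_lt_pi_div_two √P
  have e : ∫⁻ ψ in Ioo 0 (Real.pi / 2), ENNReal.ofReal (Real.sin (2 * ψ)) *
      (if P < discRadius B ψ ^ 2 then 1 else 0) =
      ∫⁻ ψ in Ioo (Real.arctan √P) (Real.pi / 2), ENNReal.ofReal (Real.sin (2 * ψ)) := by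
    rw [← lintegral_indicator measurableSet_Ioo, ← lintegral_indicator measurableSet_Ioo]
    refine lintegral_congr fun ψ => ?_
    by_cases hψ : ψ ∈ Ioo 0 (Real.pi / 2)
    · rw [indicator_of_mem hψ]
      by_cases h2 : Real.arctan √P < ψ
      · rw [indicator_of_mem (show ψ ∈ Ioo (Real.arctan √P) (Real.pi / 2) from ⟨h2, hψ.2⟩),
          if_pos ((lt_discRadius_sq_iff hB hψ).2 (lt_min h2 hPB)), mul_one]
      · rw [indicator_of_notMem (fun h => h2 h.1),
          if_neg (fun h => h2 ((lt_min_iff.1 ((lt_discRadius_sq_iff hB hψ).1 h)).1)), mul_zero]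
    · rw [indicator_of_notMem hψ, indicator_of_notMem]
      exact fun h => hψ ⟨h0.trans_lt h.1, h.2⟩
  rw [e, lintegral_deriv_eq_sub (f := fun ψ => -Real.cos ψ ^ 2) h1.le]
  · congr 1
    rw [Real.cos_pi_div_two, Real.cos_sq_arctan, Real.sq_sqrt hP]
    simp
  · fun_prop
  · intro ψ _
    refine ((Real.hasDerivAt_cos ψ).pow 2).neg.congr_deriv ?_
    rw [Real.sin_two_mul]
    push_cast
    ring
  · intro ψ hψ
    exact Real.sin_nonneg_of_nonneg_of_le_pi (by linarith [hψ.1]) (by linarith [hψ.2])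

/-- The density `∫ sin 2ψ · discDensity (discRadius B ψ) dψ` on the plane. -/
def mixedDensity (B : ℝ) (Y : ℝ × ℝ) : ℝ≥0∞ :=
  ∫⁻ ψ in Ioo 0 (Real.pi / 2), ENNReal.ofReal (Real.sin (2 * ψ)) * discDensity (discRadius B ψ) Y

lemma measurable_discRadius (B : ℝ) : Measurable (discRadius B) :=
  by
  unfold discRadius
  simp_rw [Real.tan_eq_sin_div_cos]
  fun_prop

lemma measurable_discDensity_uncurry (B : ℝ) :
    Measurable fun q : (ℝ × ℝ) × ℝ => discDensity (discRadius B q.2) q.1 := by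
  have h := measurable_discRadius B
  unfold discDensity
  fun_prop

lemma measurable_mixedDensity (B : ℝ) : Measurable (mixedDensity B) := by
  have h := measurable_discDensity_uncurry B
  unfold mixedDensity
  refine Measurable.lintegral_prod_right' (ν := volume.restrict (Ioo 0 (Real.pi / 2)))
    (f := fun q : (ℝ × ℝ) × ℝ => ENNReal.ofReal (Real.sin (2 * q.2)) *
      discDensity (discRadius B q.2) q.1) ?_
  fun_prop

lemma lintegral_mul_mixedDensity (B : ℝ) {F : ℝ × ℝ → ℝ≥0∞} (hF : Measurable F) :
    ∫⁻ Y, F Y * mixedDensity B Y = ∫⁻ ψ in Ioo 0 (Real.pi / 2),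
      ENNReal.ofReal (Real.sin (2 * ψ)) * ∫⁻ Y, F Y * discDensity (discRadius B ψ) Y := by
  have h := measurable_discDensity_uncurry B
  have hs : Measurable fun ψ : ℝ => ENNReal.ofReal (Real.sin (2 * ψ)) := by fun_prop
  have hr := measurable_discRadius B
  have h2 : ∀ ψ, Measurable fun Y => discDensity (discRadius B ψ) Y := fun ψ => by
    unfold discDensity; fun_prop
  have h3 : ∀ Y, Measurable fun ψ => discDensity (discRadius B ψ) Y := fun Y => by
    unfold discDensity; fun_prop
  have e : ∀ Y, F Y * mixedDensity B Y = ∫⁻ ψ in Ioo 0 (Real.pi / 2),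
      F Y * (ENNReal.ofReal (Real.sin (2 * ψ)) * discDensity (discRadius B ψ) Y) := fun Y => by
    rw [mixedDensity, lintegral_const_mul _ (by exact hs.mul (h3 Y))]
  have hm : Measurable (Function.uncurry fun (Y : ℝ × ℝ) (ψ : ℝ) =>
      F Y * (ENNReal.ofReal (Real.sin (2 * ψ)) * discDensity (discRadius B ψ) Y)) :=
    (hF.comp measurable_fst).mul ((hs.comp measurable_snd).mul h)
  rw [lintegral_congr e, lintegral_lintegral_swap hm.aemeasurable]
  refine lintegral_congr fun ψ => ?_
  rw [← lintegral_const_mul _ (by exact hF.mul (h2 ψ))]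
  refine lintegral_congr fun Y => ?_
  ring

lemma lineDistSq_nonneg (X : ℝ × ℝ) (m : ℝ) : 0 ≤ lineDistSq X m := by
  unfold lineDistSq; positivity

/-- Almost every line through a point `X` of a closed disc meets the open disc. -/
lemma ae_arctan_lineDist_lt {B : ℝ} (hB : 0 < B) {X : ℝ × ℝ}
    (hX : Real.arctan √(planeSq X) ≤ B) :
    ∀ᵐ m : ℝ, Real.arctan √(lineDistSq X m) < B := by
  obtain ⟨x, y⟩ := X
  have hid : ∀ m : ℝ, planeSq (x, y) - lineDistSq (x, y) m = (x + m * y) ^ 2 / (1 + m ^ 2) := by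
    intro m
    simp only [planeSq, lineDistSq]; field_simp; ring
  by_cases h0 : planeSq (x, y) = 0
  · refine Eventually.of_forall fun m => ?_
    have h1 : lineDistSq (x, y) m ≤ 0 := by
      have := hid m
      have h2 : 0 ≤ (x + m * y) ^ 2 / (1 + m ^ 2) := by positivity
      linarith
    rw [Real.sqrt_eq_zero_of_nonpos h1, Real.arctan_zero]
    exact hB
  · have hae : ∀ᵐ m : ℝ, x + m * y ≠ 0 := by
      rw [ae_iff]
      refine Set.Subsingleton.measure_zero ?_ _
      intro m hm m' hm'
      simp only [ne_eq, not_not, mem_ofPred_eq] at hm hm'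
      have hy : y ≠ 0 := by
        rintro rfl
        apply h0
        simp only [mul_zero, add_zero] at hm
        simp [planeSq, hm]
      have : (m - m') * y = 0 := by linarith
      exact sub_eq_zero.1 ((mul_eq_zero.1 this).resolve_right hy)
    filter_upwards [hae] with m hm
    refine lt_of_lt_of_le (Real.arctan_strictMono (Real.sqrt_lt_sqrt (lineDistSq_nonneg _ _) ?_)) hX
    have := hid m
    have h2 : 0 < (x + m * y) ^ 2 / (1 + m ^ 2) := by positivity
    linarith

/-- The planar potential of `mixedDensity B` on the closed disc of radius `tan B`. -/
lemma lintegral_mixedDensity_mul_inv_dist {B : ℝ} (hB : 0 < B) {X : ℝ × ℝ}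
    (hX : Real.arctan √(planeSq X) ≤ B) :
    ∫⁻ Y, ENNReal.ofReal (√(planeSq (X - Y)))⁻¹ * mixedDensity B Y =
      ENNReal.ofReal (Real.pi ^ 2 / √(1 + planeSq X)) := by
  have hr := measurable_discRadius B
  have hl : Measurable (lineDistSq X) := by unfold lineDistSq; fun_prop
  have hind : Measurable fun q : ℝ × ℝ =>
      (if lineDistSq X q.2 < discRadius B q.1 ^ 2 then (1 : ℝ≥0∞) else 0) :=
    Measurable.ite (measurableSet_lt (by fun_prop) (by fun_prop)) measurable_const measurable_const
  have hs : Measurable fun ψ : ℝ => ENNReal.ofReal (Real.sin (2 * ψ)) := by fun_prop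
  have hq : Measurable fun m : ℝ => ENNReal.ofReal (Real.pi / (1 + m ^ 2)) := by fun_prop
  have hd : Measurable fun Y : ℝ × ℝ => ENNReal.ofReal (√(planeSq (X - Y)))⁻¹ := by fun_prop
  rw [lintegral_mul_mixedDensity B hd]
  have e : ∀ ψ, ENNReal.ofReal (Real.sin (2 * ψ)) *
      ∫⁻ Y, ENNReal.ofReal (√(planeSq (X - Y)))⁻¹ * discDensity (discRadius B ψ) Y =
      ∫⁻ m : ℝ, ENNReal.ofReal (Real.sin (2 * ψ)) * (ENNReal.ofReal (Real.pi / (1 + m ^ 2)) *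
        if lineDistSq X m < discRadius B ψ ^ 2 then 1 else 0) := by
    intro ψ
    have h1 : Measurable fun m : ℝ =>
        (if lineDistSq X m < discRadius B ψ ^ 2 then (1 : ℝ≥0∞) else 0) :=
      Measurable.ite (measurableSet_lt hl measurable_const) measurable_const measurable_const
    rw [lintegral_const_mul _ (by exact hq.mul h1), ← lintegral_discDensity_mul_inv_dist]
    congr 1
    exact lintegral_congr fun Y => mul_comm _ _
  have hm : Measurable (Function.uncurry fun ψ m : ℝ => ENNReal.ofReal (Real.sin (2 * ψ)) *
      (ENNReal.ofReal (Real.pi / (1 + m ^ 2)) *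
        if lineDistSq X m < discRadius B ψ ^ 2 then 1 else 0)) :=
    (hs.comp measurable_fst).mul ((hq.comp measurable_snd).mul hind)
  rw [lintegral_congr e, lintegral_lintegral_swap hm.aemeasurable, ← lintegral_inv_one_add_lineDistSq]
  refine lintegral_congr_ae ?_
  filter_upwards [ae_arctan_lineDist_lt hB hX] with m hm
  have h1 : Measurable fun ψ : ℝ =>
      (if lineDistSq X m < discRadius B ψ ^ 2 then (1 : ℝ≥0∞) else 0) :=
    Measurable.ite (measurableSet_lt measurable_const (hr.pow_const 2)) measurable_const
      measurable_const
  rw [← lintegral_sin_mul_indicator (lineDistSq_nonneg X m) hB hm,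
    ← lintegral_const_mul _ (by exact hs.mul h1)]
  refine lintegral_congr fun ψ => ?_
  ring

/-! ### Radial moments -/

lemma lintegral_comp_planeSq {h : ℝ → ℝ≥0∞} (hh : Measurable h) :
    ∫⁻ Y, h (planeSq Y) =
      ENNReal.ofReal (2 * Real.pi) * ∫⁻ r in Ioi (0 : ℝ), ENNReal.ofReal r * h (r ^ 2) := by
  rw [← lintegral_comp_polarCoord_symm]
  have e : ∀ p : ℝ × ℝ, ENNReal.ofReal p.1 • h (planeSq (polarCoord.symm p)) =
      (fun r => ENNReal.ofReal r * h (r ^ 2)) p.1 := by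
    intro p
    simp only [smul_eq_mul, planeSq, polarCoord_symm_apply]
    congr 2
    linear_combination p.1 ^ 2 * Real.cos_sq_add_sin_sq p.2
  rw [lintegral_congr e, polarCoord_target, Measure.volume_eq_prod, ← Measure.prod_restrict,
    lintegral_prod _ (by fun_prop)]
  simp only [lintegral_const, Measure.restrict_apply MeasurableSet.univ, univ_inter,
    Real.volume_Ioo]
  rw [lintegral_mul_const _ (by fun_prop), mul_comm]
  congr 2
  ring

/-- Radial moments of `discDensity t`. The substitution `v² = (t² - r²) / (1 + r²)` turns them into
the integral of `(1 + v²) ^ (j - 1)`, whose primitive is `A`. -/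
lemma lintegral_mul_discDensity {t : ℝ} (ht : 0 < t) (j : ℕ) {A : ℝ → ℝ} (hA0 : A 0 = 0)
    (hA : ∀ v, HasDerivAt A ((1 + v ^ 2) ^ j / (1 + v ^ 2)) v) :
    ∫⁻ Y, ENNReal.ofReal ((√(1 + planeSq Y))⁻¹ * ((1 + planeSq Y)⁻¹) ^ j) * discDensity t Y =
      ENNReal.ofReal (2 * Real.pi * (((1 + t ^ 2)⁻¹) ^ j * A t)) := by
  have hpi := Real.pi_pos
  have hT : 0 < 1 + t ^ 2 := by positivity
  have hAc : Continuous A := continuous_iff_continuousAt.2 fun v => (hA v).continuousAt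
  unfold discDensity
  rw [lintegral_comp_planeSq (h := fun q => ENNReal.ofReal ((√(1 + q))⁻¹ * ((1 + q)⁻¹) ^ j) *
    ENNReal.ofReal (√(t ^ 2 - q))⁻¹) (by fun_prop), ENNReal.ofReal_mul (p := 2 * Real.pi) (by positivity)]
  congr 1
  have e : ∫⁻ r in Ioi (0 : ℝ), ENNReal.ofReal r * (ENNReal.ofReal ((√(1 + r ^ 2))⁻¹ *
      ((1 + r ^ 2)⁻¹) ^ j) * ENNReal.ofReal (√(t ^ 2 - r ^ 2))⁻¹) =
      ∫⁻ r in Ioo 0 t, ENNReal.ofReal (r * ((√(1 + r ^ 2))⁻¹ *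
        ((1 + r ^ 2)⁻¹) ^ j * (√(t ^ 2 - r ^ 2))⁻¹)) := by
    rw [← lintegral_indicator measurableSet_Ioi, ← lintegral_indicator measurableSet_Ioo]
    refine lintegral_congr fun r => ?_
    by_cases hr : r ∈ Ioo 0 t
    · have hr0 : 0 ≤ r := hr.1.le
      rw [indicator_of_mem hr, indicator_of_mem (show r ∈ Ioi (0 : ℝ) from hr.1),
        ← ENNReal.ofReal_mul (by positivity), ← ENNReal.ofReal_mul hr0]
    · rw [indicator_of_notMem hr]
      by_cases hr0 : r ∈ Ioi (0 : ℝ)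
      · have h1 : t ≤ r := not_lt.1 fun h => hr ⟨hr0, h⟩
        have : t ^ 2 - r ^ 2 ≤ 0 := by nlinarith
        rw [indicator_of_mem hr0, Real.sqrt_eq_zero_of_nonpos this]
        simp
      · rw [indicator_of_notMem hr0]
  rw [e, lintegral_deriv_eq_sub
    (f := fun r => -(((1 + t ^ 2)⁻¹) ^ j * A (√((t ^ 2 - r ^ 2) / (1 + r ^ 2))))) ht.le]
  · congr 1
    simp [Real.sqrt_sq ht.le, hA0]
  · have : ∀ r : ℝ, 1 + r ^ 2 ≠ 0 := fun r => by positivity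
    exact Continuous.continuousOn (by fun_prop (disch := exact this _))
  · intro r hr
    have hp : 0 < 1 + r ^ 2 := by positivity
    have hm : 0 < t ^ 2 - r ^ 2 := by nlinarith [hr.1, hr.2]
    have hq : 0 < (t ^ 2 - r ^ 2) / (1 + r ^ 2) := by positivity
    have h1 : HasDerivAt (fun r : ℝ => (t ^ 2 - r ^ 2) / (1 + r ^ 2))
        (-2 * r * (1 + t ^ 2) / (1 + r ^ 2) ^ 2) r := by
      have ha : HasDerivAt (fun r : ℝ => t ^ 2 - r ^ 2) (-(2 * r)) r := by
        simpa using (hasDerivAt_pow 2 r).const_sub (t ^ 2)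
      have hb : HasDerivAt (fun r : ℝ => 1 + r ^ 2) (2 * r) r := by
        simpa using (hasDerivAt_pow 2 r).const_add 1
      refine (ha.div hb hp.ne').congr_deriv ?_
      congr 1; ring
    refine ((((hA _).comp r (h1.sqrt hq.ne')).const_mul (((1 + t ^ 2)⁻¹) ^ j)).neg).congr_deriv ?_
    have h2 : 1 + √((t ^ 2 - r ^ 2) / (1 + r ^ 2)) ^ 2 = (1 + t ^ 2) / (1 + r ^ 2) := by
      rw [Real.sq_sqrt hq.le]; field_simp; ring
    rw [h2, Real.sqrt_div hm.le, div_pow, inv_pow, inv_pow]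
    have hsp : 0 < √(1 + r ^ 2) := Real.sqrt_pos.2 hp
    have hsm : 0 < √(t ^ 2 - r ^ 2) := Real.sqrt_pos.2 hm
    have hspp : √(1 + r ^ 2) ^ 2 = 1 + r ^ 2 := Real.sq_sqrt hp.le
    set u := √(1 + r ^ 2)
    rw [← hspp]
    field_simp
  · intro r hr
    have := hr.1
    positivity

/-- Integration by parts against `sin 2ψ dψ = -d(cos² ψ)`. -/
lemma lintegral_sin_mul_comp_min {B : ℝ} (hB : 0 < B) (hB' : B ≤ Real.pi / 2) {F F' K : ℝ → ℝ}
    (hF : ∀ ψ, HasDerivAt F (F' ψ) ψ) (hK : ∀ ψ, HasDerivAt K (Real.cos ψ ^ 2 * F' ψ) ψ)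
    (hF0 : F 0 = 0) (hK0 : K 0 = 0) (hpos : ∀ ψ ∈ Icc 0 (Real.pi / 2), 0 ≤ F ψ) :
    ∫⁻ ψ in Ioo 0 (Real.pi / 2), ENNReal.ofReal (Real.sin (2 * ψ)) * ENNReal.ofReal (F (min ψ B)) =
      ENNReal.ofReal (K B) := by
  have hFc : Continuous F := continuous_iff_continuousAt.2 fun v => (hF v).continuousAt
  have hKc : Continuous K := continuous_iff_continuousAt.2 fun v => (hK v).continuousAt
  have hsin : ∀ ψ, 0 ≤ ψ → ψ ≤ Real.pi / 2 → 0 ≤ Real.sin (2 * ψ) := fun ψ h1 h2 =>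
    Real.sin_nonneg_of_nonneg_of_le_pi (by linarith) (by linarith)
  have hcos : ∀ ψ, HasDerivAt (fun ψ => -Real.cos ψ ^ 2) (Real.sin (2 * ψ)) ψ := by
    intro ψ
    refine ((Real.hasDerivAt_cos ψ).pow 2).neg.congr_deriv ?_
    rw [Real.sin_two_mul]
    push_cast
    ring
  have hFB : 0 ≤ F B := hpos B ⟨hB.le, hB'⟩
  have h1 : ∫⁻ ψ in Ioo 0 B, ENNReal.ofReal (Real.sin (2 * ψ)) * ENNReal.ofReal (F (min ψ B)) =
      ENNReal.ofReal (K B - Real.cos B ^ 2 * F B) := by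
    have e : ∀ ψ ∈ Ioo 0 B, ENNReal.ofReal (Real.sin (2 * ψ)) * ENNReal.ofReal (F (min ψ B)) =
        ENNReal.ofReal (Real.sin (2 * ψ) * F ψ) := fun ψ hψ => by
      rw [min_eq_left hψ.2.le, ENNReal.ofReal_mul (hsin ψ hψ.1.le (hψ.2.le.trans hB'))]
    rw [setLIntegral_congr_fun measurableSet_Ioo e, lintegral_deriv_eq_sub
      (f := fun ψ => K ψ + -Real.cos ψ ^ 2 * F ψ) hB.le]
    · congr 1
      rw [hF0, hK0]; ring
    · exact Continuous.continuousOn (by fun_prop)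
    · intro ψ _
      refine ((hK ψ).add ((hcos ψ).mul (hF ψ))).congr_deriv ?_
      ring
    · intro ψ hψ
      exact mul_nonneg (hsin ψ hψ.1.le (hψ.2.le.trans hB')) (hpos ψ ⟨hψ.1.le, hψ.2.le.trans hB'⟩)
  have h2 : ∫⁻ ψ in Ioo B (Real.pi / 2), ENNReal.ofReal (Real.sin (2 * ψ)) *
      ENNReal.ofReal (F (min ψ B)) = ENNReal.ofReal (Real.cos B ^ 2 * F B) := by
    have e : ∀ ψ ∈ Ioo B (Real.pi / 2), ENNReal.ofReal (Real.sin (2 * ψ)) *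
        ENNReal.ofReal (F (min ψ B)) = ENNReal.ofReal (Real.sin (2 * ψ) * F B) := fun ψ hψ => by
      rw [min_eq_right hψ.1.le, ENNReal.ofReal_mul (hsin ψ (hB.trans hψ.1).le hψ.2.le)]
    rw [setLIntegral_congr_fun measurableSet_Ioo e, lintegral_deriv_eq_sub
      (f := fun ψ => -Real.cos ψ ^ 2 * F B) hB']
    · congr 1
      rw [Real.cos_pi_div_two]; ring
    · exact Continuous.continuousOn (by fun_prop)
    · intro ψ _
      exact (hcos ψ).mul_const (F B)
    · intro ψ hψ
      exact mul_nonneg (hsin ψ (hB.trans hψ.1).le hψ.2.le) hFB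
  have hK1 : 0 ≤ K B - Real.cos B ^ 2 * F B := by
    have hmono : MonotoneOn (fun ψ => K ψ + -Real.cos ψ ^ 2 * F ψ) (Icc 0 B) := by
      refine monotoneOn_of_hasDerivWithinAt_nonneg (convex_Icc 0 B)
        (f' := fun ψ => Real.sin (2 * ψ) * F ψ)
        (Continuous.continuousOn (by fun_prop)) ?_ ?_
      · intro ψ _
        refine HasDerivAt.hasDerivWithinAt ?_
        refine ((hK ψ).add ((hcos ψ).mul (hF ψ))).congr_deriv ?_
        ring
      · intro ψ hψ
        rw [interior_Icc] at hψ
        exact mul_nonneg (hsin ψ hψ.1.le (hψ.2.le.trans hB'))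
          (hpos ψ ⟨hψ.1.le, hψ.2.le.trans hB'⟩)
    have := hmono (left_mem_Icc.2 hB.le) (right_mem_Icc.2 hB.le) hB.le
    simp only [hF0, hK0] at this
    linarith
  have hdis : Disjoint (Ioc 0 B) (Ioc B (Real.pi / 2)) := by
    rw [Set.disjoint_left]
    intro x hx hx'
    exact absurd hx.2 (not_le.2 hx'.1)
  rw [setLIntegral_congr Ioo_ae_eq_Ioc, ← Ioc_union_Ioc_eq_Ioc hB.le hB',
    lintegral_union measurableSet_Ioc hdis, ← setLIntegral_congr Ioo_ae_eq_Ioc,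
    ← setLIntegral_congr Ioo_ae_eq_Ioc, h1, h2, ← ENNReal.ofReal_add hK1 (by positivity)]
  congr 1; ring

lemma lintegral_mul_mixedDensity_eq {B : ℝ} (hB : 0 < B) (hB' : B ≤ Real.pi / 2) (j : ℕ)
    {A F F' K : ℝ → ℝ} (hA0 : A 0 = 0)
    (hA : ∀ v, HasDerivAt A ((1 + v ^ 2) ^ j / (1 + v ^ 2)) v)
    (hAF : ∀ ψ ∈ Ioo 0 (Real.pi / 2),
      ((1 + Real.tan ψ ^ 2)⁻¹) ^ j * A (Real.tan ψ) = F ψ)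
    (hF : ∀ ψ, HasDerivAt F (F' ψ) ψ) (hK : ∀ ψ, HasDerivAt K (Real.cos ψ ^ 2 * F' ψ) ψ)
    (hF0 : F 0 = 0) (hK0 : K 0 = 0) (hpos : ∀ ψ ∈ Icc 0 (Real.pi / 2), 0 ≤ F ψ) :
    ∫⁻ Y, ENNReal.ofReal ((√(1 + planeSq Y))⁻¹ * ((1 + planeSq Y)⁻¹) ^ j) * mixedDensity B Y =
      ENNReal.ofReal (2 * Real.pi * K B) := by
  have hpi := Real.pi_pos
  have hFc : Continuous F := continuous_iff_continuousAt.2 fun v => (hF v).continuousAt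
  rw [lintegral_mul_mixedDensity B (by fun_prop)]
  have e : ∀ ψ ∈ Ioo 0 (Real.pi / 2), ENNReal.ofReal (Real.sin (2 * ψ)) *
      ∫⁻ Y, ENNReal.ofReal ((√(1 + planeSq Y))⁻¹ * ((1 + planeSq Y)⁻¹) ^ j) *
        discDensity (discRadius B ψ) Y = ENNReal.ofReal (2 * Real.pi) *
      (ENNReal.ofReal (Real.sin (2 * ψ)) * ENNReal.ofReal (F (min ψ B))) := by
    intro ψ hψ
    rw [lintegral_mul_discDensity (discRadius_pos hB hψ) j hA0 hA,
      ENNReal.ofReal_mul (by positivity), discRadius, hAF _ (min_mem_Ioo hB hψ)]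
    ring
  rw [setLIntegral_congr_fun measurableSet_Ioo e, lintegral_const_mul _ (by fun_prop),
    lintegral_sin_mul_comp_min hB hB' hF hK hF0 hK0 hpos,
    ENNReal.ofReal_mul (p := 2 * Real.pi) (by positivity)]

lemma lintegral_mixedDensity_moment_zero {B : ℝ} (hB : 0 < B) (hB' : B ≤ Real.pi / 2) :
    ∫⁻ Y, ENNReal.ofReal ((√(1 + planeSq Y))⁻¹ * ((1 + planeSq Y)⁻¹) ^ 0) * mixedDensity B Y =
      ENNReal.ofReal (2 * Real.pi * ((B + Real.sin B * Real.cos B) / 2)) := by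
  refine lintegral_mul_mixedDensity_eq hB hB' 0 (A := Real.arctan) (F := fun ψ => ψ)
    (F' := fun _ => 1) (K := fun ψ => (ψ + Real.sin ψ * Real.cos ψ) / 2) Real.arctan_zero ?_ ?_ ?_
    ?_ rfl (by simp) fun ψ hψ => hψ.1
  · intro v
    simpa using Real.hasDerivAt_arctan v
  · intro ψ hψ
    rw [Real.arctan_tan (by linarith [hψ.1, Real.pi_pos]) hψ.2]
    simp
  · exact fun ψ => hasDerivAt_id' ψ
  · intro ψ
    refine (((hasDerivAt_id' ψ).add ((Real.hasDerivAt_sin ψ).mul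
      (Real.hasDerivAt_cos ψ))).div_const 2).congr_deriv ?_
    linear_combination -(1 / 2) * Real.sin_sq_add_cos_sq ψ

lemma lintegral_mixedDensity_moment_one {B : ℝ} (hB : 0 < B) (hB' : B ≤ Real.pi / 2) :
    ∫⁻ Y, ENNReal.ofReal ((√(1 + planeSq Y))⁻¹ * ((1 + planeSq Y)⁻¹) ^ 1) * mixedDensity B Y =
      ENNReal.ofReal (2 * Real.pi * ((B + Real.sin B * Real.cos B) / 4 +
        Real.sin B * Real.cos B ^ 3 / 2)) := by
  refine lintegral_mul_mixedDensity_eq hB hB' 1 (A := fun v => v)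
    (F := fun ψ => Real.sin ψ * Real.cos ψ)
    (F' := fun ψ => Real.cos ψ * Real.cos ψ + Real.sin ψ * -Real.sin ψ)
    (K := fun ψ => (ψ + Real.sin ψ * Real.cos ψ) / 4 + Real.sin ψ * Real.cos ψ ^ 3 / 2) rfl ?_ ?_ ?_
    ?_ (by simp) (by simp) ?_
  · intro v
    refine (hasDerivAt_id' v).congr_deriv ?_
    have : 1 + v ^ 2 ≠ 0 := by positivity
    field_simp
  · intro ψ hψ
    have hc : Real.cos ψ ≠ 0 :=
      (Real.cos_pos_of_mem_Ioo ⟨by linarith [hψ.1, Real.pi_pos], hψ.2⟩).ne'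
    rw [Real.inv_one_add_tan_sq hc, Real.tan_eq_sin_div_cos]
    field_simp
  · exact fun ψ => (Real.hasDerivAt_sin ψ).mul (Real.hasDerivAt_cos ψ)
  · intro ψ
    have h := (Real.hasDerivAt_sin ψ).mul (Real.hasDerivAt_cos ψ)
    refine ((((hasDerivAt_id' ψ).add h).div_const 4).add (((Real.hasDerivAt_sin ψ).mul
      ((Real.hasDerivAt_cos ψ).pow 3)).div_const 2)).congr_deriv ?_
    push_cast
    simp only [Pi.pow_apply]
    have hs : Real.sin ψ ^ 2 = 1 - Real.cos ψ ^ 2 := Real.sin_sq ψ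
    generalize Real.sin ψ = s at *
    generalize Real.cos ψ = c at *
    linear_combination (-1 / 4 - c ^ 2 / 2) * hs
  · intro ψ hψ
    exact mul_nonneg (Real.sin_nonneg_of_nonneg_of_le_pi hψ.1 (by linarith [hψ.2, Real.pi_pos]))
      (Real.cos_nonneg_of_mem_Icc ⟨by linarith [hψ.1, Real.pi_pos], hψ.2⟩)

lemma lintegral_mixedDensity_moment_two {B : ℝ} (hB : 0 < B) (hB' : B ≤ Real.pi / 2) :
    ∫⁻ Y, ENNReal.ofReal ((√(1 + planeSq Y))⁻¹ * ((1 + planeSq Y)⁻¹) ^ 2) * mixedDensity B Y =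
      ENNReal.ofReal (2 * Real.pi * ((B + Real.sin B * Real.cos B) / 6 +
        4 / 9 * (Real.sin B * Real.cos B ^ 5) + 2 / 9 * (Real.sin B * Real.cos B ^ 3))) := by
  refine lintegral_mul_mixedDensity_eq hB hB' 2 (A := fun v => v + v ^ 3 / 3)
    (F := fun ψ => Real.sin ψ * Real.cos ψ ^ 3 + Real.sin ψ ^ 3 * Real.cos ψ / 3)
    (F' := fun ψ => Real.cos ψ ^ 4 - 2 * Real.sin ψ ^ 2 * Real.cos ψ ^ 2 - Real.sin ψ ^ 4 / 3)
    (K := fun ψ => (ψ + Real.sin ψ * Real.cos ψ) / 6 +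
        4 / 9 * (Real.sin ψ * Real.cos ψ ^ 5) + 2 / 9 * (Real.sin ψ * Real.cos ψ ^ 3))
    (by simp) ?_ ?_ ?_ ?_ (by simp) (by simp) ?_
  · intro v
    refine ((hasDerivAt_id' v).add ((hasDerivAt_pow 3 v).div_const 3)).congr_deriv ?_
    have : 1 + v ^ 2 ≠ 0 := by positivity
    field_simp
    push_cast
    ring
  · intro ψ hψ
    have hc : Real.cos ψ ≠ 0 :=
      (Real.cos_pos_of_mem_Ioo ⟨by linarith [hψ.1, Real.pi_pos], hψ.2⟩).ne'
    rw [Real.inv_one_add_tan_sq hc, Real.tan_eq_sin_div_cos]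
    field_simp
  · intro ψ
    have hs := Real.hasDerivAt_sin ψ
    have hc := Real.hasDerivAt_cos ψ
    refine ((hs.mul (hc.pow 3)).add (((hs.pow 3).mul hc).div_const 3)).congr_deriv ?_
    push_cast
    simp only [Pi.pow_apply]
    ring
  · intro ψ
    have hs := Real.hasDerivAt_sin ψ
    have hc := Real.hasDerivAt_cos ψ
    refine (((((hasDerivAt_id' ψ).add (hs.mul hc)).div_const 6).add
      ((hs.mul (hc.pow 5)).const_mul (4 / 9))).add
      ((hs.mul (hc.pow 3)).const_mul (2 / 9))).congr_deriv ?_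
    push_cast
    simp only [Pi.pow_apply]
    have hsq : Real.sin ψ ^ 2 = 1 - Real.cos ψ ^ 2 := Real.sin_sq ψ
    have hsq4 : Real.sin ψ ^ 4 = (1 - Real.cos ψ ^ 2) ^ 2 := by rw [← hsq]; ring
    generalize Real.sin ψ = s at *
    generalize Real.cos ψ = c at *
    linear_combination (-1 / 6 - 20 / 9 * c ^ 4 - 2 / 3 * c ^ 2 + 2 * c ^ 4) * hsq +
      c ^ 2 / 3 * hsq4
  · intro ψ hψ
    have h1 := Real.sin_nonneg_of_nonneg_of_le_pi hψ.1 (by linarith [hψ.2, Real.pi_pos])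
    have h2 := Real.cos_nonneg_of_mem_Icc (x := ψ) ⟨by linarith [hψ.1, Real.pi_pos], hψ.2⟩
    positivity

/-! ### The equilibrium measure of the spherical cap -/

/-- Inverse stereographic projection from the North Pole; the origin goes to the South Pole. -/
def stereo (Y : ℝ × ℝ) : E3 :=
  !₂[2 * Y.1 / (1 + planeSq Y), 2 * Y.2 / (1 + planeSq Y), (planeSq Y - 1) / (1 + planeSq Y)]

lemma one_add_planeSq_pos (Y : ℝ × ℝ) : 0 < 1 + planeSq Y := by
  have := planeSq_nonneg Y
  linarith

lemma continuous_stereo : Continuous stereo := by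
  have h : ∀ Y, 1 + planeSq Y ≠ 0 := fun Y => (one_add_planeSq_pos Y).ne'
  refine (PiLp.continuous_toLp 2 _).comp (continuous_pi fun i => ?_)
  fin_cases i <;> simp <;> fun_prop (disch := exact h _)

lemma dist_stereo (X Y : ℝ × ℝ) :
    dist (stereo X) (stereo Y) =
      2 * √(planeSq (X - Y)) / (√(1 + planeSq X) * √(1 + planeSq Y)) := by
  have hX := one_add_planeSq_pos X
  have hY := one_add_planeSq_pos Y
  rw [EuclideanSpace.dist_eq, Fin.sum_univ_three]
  have e : dist (stereo X 0) (stereo Y 0) ^ 2 + dist (stereo X 1) (stereo Y 1) ^ 2 +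
      dist (stereo X 2) (stereo Y 2) ^ 2 =
      2 ^ 2 * planeSq (X - Y) / ((1 + planeSq X) * (1 + planeSq Y)) := by
    simp only [Real.dist_eq, sq_abs, stereo, PiLp.toLp_apply, Matrix.cons_val_zero,
      Matrix.cons_val_one, Matrix.cons_val]
    field_simp
    simp only [planeSq, Prod.fst_sub, Prod.snd_sub]
    ring
  rw [e, Real.sqrt_div (mul_nonneg (by positivity) (planeSq_nonneg _)), Real.sqrt_mul (by positivity),
    Real.sqrt_sq (by norm_num), Real.sqrt_mul hX.le]

lemma inv_edist_stereo {X Y : ℝ × ℝ} (h : Y ≠ X) :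
    (edist (stereo X) (stereo Y))⁻¹ = ENNReal.ofReal (√(1 + planeSq X) / 2) *
      (ENNReal.ofReal (√(1 + planeSq Y)) * ENNReal.ofReal (√(planeSq (X - Y)))⁻¹) := by
  have hX := Real.sqrt_pos.2 (one_add_planeSq_pos X)
  have hY := Real.sqrt_pos.2 (one_add_planeSq_pos Y)
  have hd : 0 < planeSq (X - Y) := by
    refine (planeSq_nonneg _).lt_of_ne' fun h0 => h ?_
    unfold planeSq at h0
    have h1 : (X - Y).1 = 0 := by nlinarith [sq_nonneg (X - Y).1, sq_nonneg (X - Y).2]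
    have h2 : (X - Y).2 = 0 := by nlinarith [sq_nonneg (X - Y).1, sq_nonneg (X - Y).2]
    exact (sub_eq_zero.1 (Prod.ext h1 h2)).symm
  have hd' := Real.sqrt_pos.2 hd
  rw [edist_dist, dist_stereo, ← ENNReal.ofReal_inv_of_pos (by positivity),
    ← ENNReal.ofReal_mul hY.le, ← ENNReal.ofReal_mul (by positivity)]
  congr 1
  field_simp

lemma stereo_polar (r θ : ℝ) :
    stereo (r * Real.cos θ, r * Real.sin θ) = spherePoint θ (Real.pi - 2 * Real.arctan r) := by
  have hq : planeSq (r * Real.cos θ, r * Real.sin θ) = r ^ 2 := by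
    simp only [planeSq]
    linear_combination r ^ 2 * Real.cos_sq_add_sin_sq θ
  have hp : 0 < 1 + r ^ 2 := by positivity
  have hs : Real.sin (Real.pi - 2 * Real.arctan r) = 2 * r / (1 + r ^ 2) := by
    rw [Real.sin_pi_sub, Real.sin_two_mul, Real.sin_arctan, Real.cos_arctan, mul_assoc,
      div_mul_div_comm, Real.mul_self_sqrt hp.le]
    ring
  have hc : Real.cos (Real.pi - 2 * Real.arctan r) = (r ^ 2 - 1) / (1 + r ^ 2) := by
    rw [Real.cos_pi_sub, Real.cos_two_mul, Real.cos_sq_arctan]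
    field_simp
    ring
  ext i
  fin_cases i
  · simp only [stereo, spherePoint, hq, hs]
    simp
    ring
  · simp only [stereo, spherePoint, hq, hs]
    simp
    ring
  · simp only [stereo, spherePoint, hq, hc]
    simp

lemma stereo_mem_southCap {α : ℝ} {Y : ℝ × ℝ}
    (hY : Real.arctan √(planeSq Y) ≤ (Real.pi - α) / 2) : stereo Y ∈ southCap α := by
  set z : ℂ := ⟨Y.1, Y.2⟩ with hz
  have hn : ‖z‖ = √(planeSq Y) := by
    rw [Complex.norm_eq_sqrt_sq_add_sq, planeSq]
  obtain ⟨θ, hθ0, hθ1, hc, hs⟩ : ∃ θ, 0 ≤ θ ∧ θ ≤ 2 * Real.pi ∧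
      Real.cos θ = Real.cos z.arg ∧ Real.sin θ = Real.sin z.arg := by
    have h1 := Complex.neg_pi_lt_arg z
    have h2 := Complex.arg_le_pi z
    rcases le_or_gt 0 z.arg with h | h
    · exact ⟨z.arg, h, by linarith [Real.pi_pos], rfl, rfl⟩
    · exact ⟨z.arg + 2 * Real.pi, by linarith, by linarith, Real.cos_add_two_pi _,
        Real.sin_add_two_pi _⟩
  have hYz : Y = (√(planeSq Y) * Real.cos θ, √(planeSq Y) * Real.sin θ) := by
    rw [hc, hs, ← hn, Complex.norm_mul_cos_arg, Complex.norm_mul_sin_arg]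
  have h0 := Real.arctan_nonneg.2 (Real.sqrt_nonneg (planeSq Y))
  refine ⟨θ, Real.pi - 2 * Real.arctan √(planeSq Y), hθ0, hθ1, by linarith, by linarith, ?_⟩
  rw [← stereo_polar, ← hYz]

lemma exists_stereo_eq {α : ℝ} (hα : 0 ≤ α) {x : E3} (hx : x ∈ southCap α)
    (hN : x ≠ !₂[0, 0, 1]) :
    ∃ X, Real.arctan √(planeSq X) ≤ (Real.pi - α) / 2 ∧ stereo X = x := by
  obtain ⟨θ, φ, -, -, hφ, hφ', rfl⟩ := hx
  have hφ0 : 0 < φ := by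
    refine (hα.trans hφ).lt_of_ne fun h => hN ?_
    rw [← h]
    ext i
    fin_cases i <;> simp [spherePoint]
  set u := (Real.pi - φ) / 2 with hu
  have hu0 : 0 ≤ u := by rw [hu]; linarith
  have hu1 : u < Real.pi / 2 := by rw [hu]; linarith
  have ht : 0 ≤ Real.tan u := Real.tan_nonneg_of_nonneg_of_le_pi_div_two hu0 hu1.le
  have hat : Real.arctan (Real.tan u) = u := Real.arctan_tan (by linarith [Real.pi_pos]) hu1
  refine ⟨(Real.tan u * Real.cos θ, Real.tan u * Real.sin θ), ?_, ?_⟩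
  · have hq : planeSq (Real.tan u * Real.cos θ, Real.tan u * Real.sin θ) = Real.tan u ^ 2 := by
      simp only [planeSq]
      linear_combination Real.tan u ^ 2 * Real.cos_sq_add_sin_sq θ
    rw [hq, Real.sqrt_sq ht, hat]
    linarith
  · rw [stereo_polar, hat]
    congr 1
    rw [hu]; ring

lemma isCompact_southCap (α : ℝ) : IsCompact (southCap α) := by
  have h : southCap α = (fun p : ℝ × ℝ => spherePoint p.1 p.2) ''
      (Icc 0 (2 * Real.pi) ×ˢ Icc α Real.pi) := by
    ext x
    constructor
    · rintro ⟨θ, φ, h1, h2, h3, h4, rfl⟩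
      exact ⟨(θ, φ), ⟨⟨h1, h2⟩, h3, h4⟩, rfl⟩
    · rintro ⟨⟨θ, φ⟩, ⟨⟨h1, h2⟩, h3, h4⟩, rfl⟩
      exact ⟨θ, φ, h1, h2, h3, h4, rfl⟩
  rw [h]
  refine (isCompact_Icc.prod isCompact_Icc).image ?_
  refine (PiLp.continuous_toLp 2 _).comp (continuous_pi fun i => ?_)
  fin_cases i <;> simp <;> fun_prop

/-- The unit measure on the sphere obtained from `mixedDensity B` by stereographic projection. The
factor `(√(1 + |Y|²))⁻¹` cancels the one that the Newtonian kernel acquires under the projection, and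
the constant normalises the total mass to `1`. -/
def capMeasure (B : ℝ) : Measure E3 :=
  (ENNReal.ofReal (Real.pi * (B + Real.sin B * Real.cos B))⁻¹ • volume.withDensity
    fun Y => ENNReal.ofReal (√(1 + planeSq Y))⁻¹ * mixedDensity B Y).map stereo

lemma measurable_capDensity (B : ℝ) :
    Measurable fun Y => ENNReal.ofReal (√(1 + planeSq Y))⁻¹ * mixedDensity B Y := by
  have := measurable_mixedDensity B
  fun_prop

lemma lintegral_capMeasure (B : ℝ) {f : E3 → ℝ≥0∞} (hf : Measurable f) :
    ∫⁻ x, f x ∂(capMeasure B) = ENNReal.ofReal (Real.pi * (B + Real.sin B * Real.cos B))⁻¹ *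
      ∫⁻ Y, ENNReal.ofReal (√(1 + planeSq Y))⁻¹ * mixedDensity B Y * f (stereo Y) := by
  have hs := continuous_stereo.measurable
  rw [capMeasure, lintegral_map hf hs, lintegral_smul_measure,
    lintegral_withDensity_eq_lintegral_mul _ (measurable_capDensity B) (by exact hf.comp hs)]
  rfl

lemma capFactor_pos {B : ℝ} (hB : 0 < B) (hB' : B ≤ Real.pi / 2) :
    0 < Real.pi * (B + Real.sin B * Real.cos B) := by
  have h1 := Real.sin_nonneg_of_nonneg_of_le_pi hB.le (by linarith [Real.pi_pos])
  have h2 := Real.cos_nonneg_of_mem_Icc (x := B) ⟨by linarith [Real.pi_pos], hB'⟩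
  have := Real.pi_pos
  positivity

/-- The moments of the height function `(1 - x₃) / 2`, which is `1 / (1 + |Y|²)` in the plane. -/
lemma lintegral_height_pow_capMeasure {B : ℝ} (hB : 0 < B) (hB' : B ≤ Real.pi / 2) (j : ℕ) {K : ℝ}
    (hK : ∫⁻ Y, ENNReal.ofReal ((√(1 + planeSq Y))⁻¹ * ((1 + planeSq Y)⁻¹) ^ j) *
      mixedDensity B Y = ENNReal.ofReal (2 * Real.pi * K)) :
    ∫⁻ x, ENNReal.ofReal (((1 - x 2) / 2) ^ j) ∂(capMeasure B) =
      ENNReal.ofReal (2 * K / (B + Real.sin B * Real.cos B)) := by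
  have hpi := Real.pi_pos
  have hpos := capFactor_pos hB hB'
  have e : ∀ Y, ENNReal.ofReal (√(1 + planeSq Y))⁻¹ * mixedDensity B Y *
      ENNReal.ofReal (((1 - stereo Y 2) / 2) ^ j) =
      ENNReal.ofReal ((√(1 + planeSq Y))⁻¹ * ((1 + planeSq Y)⁻¹) ^ j) * mixedDensity B Y := by
    intro Y
    have hY := one_add_planeSq_pos Y
    have h1 : (1 - stereo Y 2) / 2 = (1 + planeSq Y)⁻¹ := by
      simp only [stereo, PiLp.toLp_apply, Matrix.cons_val]
      field_simp
      ring
    rw [h1, ENNReal.ofReal_mul (by positivity)]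
    ring
  rw [lintegral_capMeasure B (by fun_prop), lintegral_congr e, hK, ← ENNReal.ofReal_mul
    (by positivity)]
  congr 1
  field_simp

lemma isProbabilityMeasure_capMeasure {B : ℝ} (hB : 0 < B) (hB' : B ≤ Real.pi / 2) :
    IsProbabilityMeasure (capMeasure B) := by
  have h := lintegral_height_pow_capMeasure hB hB' 0 (lintegral_mixedDensity_moment_zero hB hB')
  have hpos : B + Real.sin B * Real.cos B ≠ 0 :=
    (pos_of_mul_pos_right (capFactor_pos hB hB') Real.pi_pos.le).ne'
  refine ⟨?_⟩
  simp only [pow_zero, ENNReal.ofReal_one, lintegral_one] at h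
  rw [h, mul_div_cancel₀ _ (two_ne_zero' ℝ), div_self hpos, ENNReal.ofReal_one]

lemma mixedDensity_eq_zero {B : ℝ} (hB : 0 < B) {Y : ℝ × ℝ}
    (hY : B ≤ Real.arctan √(planeSq Y)) : mixedDensity B Y = 0 := by
  rw [mixedDensity, setLIntegral_congr_fun measurableSet_Ioo (g := fun _ => 0), lintegral_zero]
  intro ψ hψ
  have h : ¬ planeSq Y < discRadius B ψ ^ 2 := by
    rw [lt_discRadius_sq_iff hB hψ]
    exact not_lt.2 ((min_le_right _ _).trans hY)
  simp only [discDensity]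
  rw [Real.sqrt_eq_zero_of_nonpos (by linarith)]
  simp

lemma capMeasure_compl_southCap {α : ℝ} (hα : α < Real.pi) :
    capMeasure ((Real.pi - α) / 2) (southCap α)ᶜ = 0 := by
  have hm : MeasurableSet (southCap α)ᶜ := (isCompact_southCap α).isClosed.measurableSet.compl
  rw [← lintegral_indicator_one hm, lintegral_capMeasure _ (measurable_one.indicator hm),
    lintegral_eq_zero_of_ae_eq_zero, mul_zero]
  refine Eventually.of_forall fun Y => ?_
  by_cases hY : Real.arctan √(planeSq Y) ≤ (Real.pi - α) / 2
  · simp [stereo_mem_southCap hY]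
  · simp [mixedDensity_eq_zero (by linarith) (not_le.1 hY).le]

lemma capMeasure_northPole (B : ℝ) : capMeasure B {!₂[0, 0, 1]} = 0 := by
  rw [← lintegral_indicator_one (measurableSet_singleton _),
    lintegral_capMeasure _ (measurable_one.indicator (measurableSet_singleton _)),
    lintegral_eq_zero_of_ae_eq_zero, mul_zero]
  refine Eventually.of_forall fun Y => ?_
  have h : stereo Y ∉ ({!₂[0, 0, 1]} : Set E3) := by
    intro h
    have h2 : stereo Y 2 = (!₂[0, 0, 1] : E3) 2 := by rw [mem_singleton_iff.1 h]
    simp only [stereo, PiLp.toLp_apply, Matrix.cons_val] at h2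
    rw [div_eq_one_iff_eq (one_add_planeSq_pos Y).ne'] at h2
    linarith
  simp [h]

/-- The potential of `capMeasure B` is constant on the cap, possibly except at the North Pole. -/
lemma potential_capMeasure {B : ℝ} (hB : 0 < B) (hB' : B ≤ Real.pi / 2) {X : ℝ × ℝ}
    (hX : Real.arctan √(planeSq X) ≤ B) :
    ∫⁻ y, (edist (stereo X) y)⁻¹ ∂(capMeasure B) =
      ENNReal.ofReal (Real.pi / (2 * (B + Real.sin B * Real.cos B))) := by
  have hpi := Real.pi_pos
  have hpos := capFactor_pos hB hB'
  have hq := Real.sqrt_pos.2 (one_add_planeSq_pos X)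
  have hm := measurable_mixedDensity B
  have e : ∀ᵐ Y : ℝ × ℝ, ENNReal.ofReal (√(1 + planeSq Y))⁻¹ * mixedDensity B Y *
      (edist (stereo X) (stereo Y))⁻¹ = ENNReal.ofReal (√(1 + planeSq X) / 2) *
        (ENNReal.ofReal (√(planeSq (X - Y)))⁻¹ * mixedDensity B Y) := by
    have : ∀ᵐ Y : ℝ × ℝ, Y ≠ X := by simp [ae_iff]
    filter_upwards [this] with Y hY
    have hs := Real.sqrt_pos.2 (one_add_planeSq_pos Y)
    have h1 : ENNReal.ofReal (√(1 + planeSq Y))⁻¹ * ENNReal.ofReal √(1 + planeSq Y) = 1 := by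
      rw [← ENNReal.ofReal_mul (by positivity), inv_mul_cancel₀ hs.ne', ENNReal.ofReal_one]
    rw [inv_edist_stereo hY]
    calc _ = (ENNReal.ofReal (√(1 + planeSq Y))⁻¹ * ENNReal.ofReal √(1 + planeSq Y)) *
          (ENNReal.ofReal (√(1 + planeSq X) / 2) *
            (ENNReal.ofReal (√(planeSq (X - Y)))⁻¹ * mixedDensity B Y)) := by ring
      _ = _ := by rw [h1, one_mul]
  rw [lintegral_capMeasure B (by fun_prop), lintegral_congr_ae e,
    lintegral_const_mul _ (by fun_prop), lintegral_mixedDensity_mul_inv_dist hB hX,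
    ← ENNReal.ofReal_mul (by positivity), ← ENNReal.ofReal_mul (by positivity)]
  congr 1
  have : B + Real.sin B * Real.cos B ≠ 0 := (pos_of_mul_pos_right hpos hpi.le).ne'
  field_simp

/-- `capMeasure` is the unique equilibrium measure of the spherical cap. -/
lemma isEquilibriumMeasure_southCap_iff {α : ℝ} (hα₀ : 0 ≤ α) (hα : α < Real.pi) :
    minEnergy (southCap α) = ENNReal.ofReal (Real.pi / (Real.pi - α + Real.sin α)) ∧
    ∀ μ, IsEquilibriumMeasure (southCap α) μ ↔ μ = capMeasure ((Real.pi - α) / 2) := by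
  set B := (Real.pi - α) / 2 with hBdef
  have hB : 0 < B := by rw [hBdef]; linarith
  have hB' : B ≤ Real.pi / 2 := by rw [hBdef]; linarith
  have hW : 2 * (B + Real.sin B * Real.cos B) = Real.pi - α + Real.sin α := by
    have h1 : 2 * B = Real.pi - α := by rw [hBdef]; ring
    rw [mul_add, ← mul_assoc, ← Real.sin_two_mul, h1, Real.sin_pi_sub]
  have hp := isProbabilityMeasure_capMeasure hB hB'
  have hc : capMeasure B (southCap α)ᶜ = 0 := capMeasure_compl_southCap hα
  have hpot : ∀ x ∈ southCap α, x ≠ !₂[0, 0, 1] → ∫⁻ y, (edist x y)⁻¹ ∂(capMeasure B) =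
      ENNReal.ofReal (Real.pi / (Real.pi - α + Real.sin α)) := by
    intro x hx hxN
    obtain ⟨X, hX, rfl⟩ := exists_stereo_eq hα₀ hx hxN
    rw [potential_capMeasure hB hB' hX, hW]
  refine isEquilibriumMeasure_iff_of_potential !₂[0, 0, 1] ⟨hp, hc⟩ ENNReal.ofReal_ne_top ?_ hpot
  have hae : ∀ᵐ x ∂(capMeasure B), ∫⁻ y, (edist x y)⁻¹ ∂(capMeasure B) =
      ENNReal.ofReal (Real.pi / (Real.pi - α + Real.sin α)) := by
    have h1 : ∀ᵐ x ∂(capMeasure B), x ∈ southCap α := by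
      rw [ae_iff]; exact hc
    have h2 : ∀ᵐ x ∂(capMeasure B), x ≠ !₂[0, 0, 1] := by
      rw [ae_iff]
      simpa using capMeasure_northPole B
    filter_upwards [h1, h2] with x hx1 hx2 using hpot x hx1 hx2
  rw [energy, lintegral_congr_ae hae]
  simp

lemma integral_quadraticField_capMeasure (a b c : ℝ) {α : ℝ} (hα₀ : 0 ≤ α) (hα : α < Real.pi)
    {B : ℝ} (hBdef : B = (Real.pi - α) / 2) :
    ∫ x, quadraticField a b c x ∂(capMeasure B) =
      (a + b + c) - (4 * a + 2 * b) * (2 * ((B + Real.sin B * Real.cos B) / 4 +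
        Real.sin B * Real.cos B ^ 3 / 2) / (B + Real.sin B * Real.cos B)) +
      4 * a * (2 * ((B + Real.sin B * Real.cos B) / 6 +
        4 / 9 * (Real.sin B * Real.cos B ^ 5) + 2 / 9 * (Real.sin B * Real.cos B ^ 3)) /
        (B + Real.sin B * Real.cos B)) := by
  have hB : 0 < B := by rw [hBdef]; linarith
  have hB' : B ≤ Real.pi / 2 := by rw [hBdef]; linarith
  have hp := isProbabilityMeasure_capMeasure hB hB'
  have hs := Real.sin_nonneg_of_nonneg_of_le_pi hB.le (by linarith [Real.pi_pos])
  have hcos := Real.cos_nonneg_of_mem_Icc (x := B) ⟨by linarith [Real.pi_pos], hB'⟩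
  have hbd : ∀ᵐ x ∂(capMeasure B), 0 ≤ (1 - x 2) / 2 ∧ (1 - x 2) / 2 ≤ 1 := by
    have h1 : ∀ᵐ x ∂(capMeasure B), x ∈ southCap α := by
      rw [ae_iff, hBdef]; exact capMeasure_compl_southCap hα
    filter_upwards [h1] with x hx
    obtain ⟨θ, φ, -, -, -, -, rfl⟩ := hx
    have h2 := Real.neg_one_le_cos φ
    have h3 := Real.cos_le_one φ
    simp only [spherePoint, PiLp.toLp_apply, Matrix.cons_val]
    constructor <;> linarith
  have hint : ∀ j : ℕ, Integrable (fun x : E3 => ((1 - x 2) / 2) ^ j) (capMeasure B) := by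
    intro j
    refine Integrable.of_bound (C := 1) (Measurable.aestronglyMeasurable (by fun_prop)) ?_
    filter_upwards [hbd] with x hx
    rw [Real.norm_of_nonneg (pow_nonneg hx.1 j)]
    exact pow_le_one₀ hx.1 hx.2
  have hmom : ∀ (j : ℕ) (K : ℝ), 0 ≤ K →
      ∫⁻ Y, ENNReal.ofReal ((√(1 + planeSq Y))⁻¹ * ((1 + planeSq Y)⁻¹) ^ j) *
        mixedDensity B Y = ENNReal.ofReal (2 * Real.pi * K) →
      ∫ x, ((1 - x 2) / 2) ^ j ∂(capMeasure B) = 2 * K / (B + Real.sin B * Real.cos B) := by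
    intro j K hK h
    rw [integral_eq_lintegral_of_nonneg_ae (hbd.mono fun x hx => pow_nonneg hx.1 j)
      (hint j).aestronglyMeasurable, lintegral_height_pow_capMeasure hB hB' j h,
      ENNReal.toReal_ofReal (by positivity)]
  -- `Q` as a polynomial in the height `(1 - x₃) / 2`, whose moments are known.
  have e : ∀ x : E3, quadraticField a b c x = (a + b + c) -
      (4 * a + 2 * b) * ((1 - x 2) / 2) ^ 1 + 4 * a * ((1 - x 2) / 2) ^ 2 := by
    intro x
    simp only [quadraticField]
    ring
  simp_rw [e]
  rw [integral_add (by exact (integrable_const _).sub ((hint 1).const_mul _))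
      ((hint 2).const_mul _),
    integral_sub (integrable_const _) ((hint 1).const_mul _), integral_const_mul,
    integral_const_mul, hmom 1 _ (by positivity) (lintegral_mixedDensity_moment_one hB hB'),
    hmom 2 _ (by positivity) (lintegral_mixedDensity_moment_two hB hB')]
  simp

end NewtonSphere

end

theorem mainTheorem11 (a b c α : ℝ) (hα₀ : 0 ≤ α) (hα : α < Real.pi) :
    0 < NewtonSphere.capacity (NewtonSphere.southCap α) ∧
    (∃! μ : MeasureTheory.Measure NewtonSphere.E3,
      NewtonSphere.IsEquilibriumMeasure (NewtonSphere.southCap α) μ) ∧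
    NewtonSphere.FFunctional (NewtonSphere.quadraticField a b c) (NewtonSphere.southCap α) =
      1 / (36 * (Real.pi - α + Real.sin α)) *
        (Real.tan (α / 2) *
            (32 * a * Real.cos α ^ 3 + 4 * (2 * a + 9 * b) * Real.cos α ^ 2
              + 4 * (9 * c - 5 * a) * Real.cos α + 4 * a - 36 * b + 36 * c)
          + 12 * (a + 3 * c) * (Real.pi - α) + 36 * Real.pi) := by
  obtain ⟨hmin, hiff⟩ := NewtonSphere.isEquilibriumMeasure_southCap_iff hα₀ hα
  have heq : NewtonSphere.equilibriumMeasure (NewtonSphere.southCap α) =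
      NewtonSphere.capMeasure ((Real.pi - α) / 2) := by
    have hex : ∃ μ, NewtonSphere.IsEquilibriumMeasure (NewtonSphere.southCap α) μ :=
      ⟨_, (hiff _).2 rfl⟩
    rw [NewtonSphere.equilibriumMeasure, dif_pos hex]
    exact (hiff _).1 hex.choose_spec
  refine ⟨?_, ⟨_, (hiff _).2 rfl, fun μ hμ => (hiff μ).1 hμ⟩, ?_⟩
  · rw [NewtonSphere.capacity, hmin]
    exact ENNReal.inv_pos.2 ENNReal.ofReal_ne_top
  · have hsin : 0 ≤ Real.sin α := Real.sin_nonneg_of_nonneg_of_le_pi hα₀ hα.le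
    have hpi := Real.pi_pos
    have hD : 0 < Real.pi - α + Real.sin α := by linarith
    have hch : 0 < Real.cos (α / 2) := Real.cos_pos_of_mem_Ioo ⟨by linarith, by linarith⟩
    rw [NewtonSphere.FFunctional, heq, hmin, ENNReal.toReal_ofReal (by positivity),
      NewtonSphere.integral_quadraticField_capMeasure a b c hα₀ hα rfl]
    have hsB : Real.sin ((Real.pi - α) / 2) = Real.cos (α / 2) := by
      rw [← Real.sin_pi_div_two_sub]; congr 1; ring
    have hcB : Real.cos ((Real.pi - α) / 2) = Real.sin (α / 2) := by
      rw [← Real.cos_pi_div_two_sub]; congr 1; ring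
    have hsα : Real.sin α = 2 * Real.sin (α / 2) * Real.cos (α / 2) := by
      rw [← Real.sin_two_mul]; congr 1; ring
    have hcα : Real.cos α = 2 * Real.cos (α / 2) ^ 2 - 1 := by
      rw [← Real.cos_two_mul]; congr 1; ring
    have hsc : Real.sin (α / 2) ^ 2 = 1 - Real.cos (α / 2) ^ 2 := Real.sin_sq _
    rw [hsB, hcB, hcα, Real.tan_eq_sin_div_cos]
    have hE : (Real.pi - α) / 2 + Real.cos (α / 2) * Real.sin (α / 2) =
        (Real.pi - α + Real.sin α) / 2 := by rw [hsα]; ring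
    rw [hE]
    have h3 : Real.sin (α / 2) ^ 3 = Real.sin (α / 2) * (1 - Real.cos (α / 2) ^ 2) := by
      rw [← hsc]; ring
    have h5 : Real.sin (α / 2) ^ 5 = Real.sin (α / 2) * (1 - Real.cos (α / 2) ^ 2) ^ 2 := by
      rw [← hsc]; ring
    rw [h3, h5]
    field_simp
    rw [hsα]
    ring
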